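/- **Theorem (FRECON in the nonconvex case).** Let $f=\frac1N\sum_{i=1}^N f_i:\mathbb R^d\to\mathbb R$ be bounded below, $f^*=\inf f$, where every $f_i$ is differentiable with $\|\nabla f_i(x)-\nabla f_i(y)\|\le L\|x-y\|$ for all $x,y$ ($L>0$). Client $i$ has a stochastic gradient oracle $\tilde\nabla f_i(x)$ with $\mathbb E\,\tilde\nabla f_i(x)=\nabla f_i(x)$ and $\mathbb E\|\tilde\nabla f_i(x)-\nabla f_i(x)\|^2\le\sigma^2$ for all $x$; $\tilde\nabla_b f_i$ is the average of $b$ independent such gradients. Let $\mathcal C$ be an $\omega$-compression operator, i.e. a randomized map with $\mathbb E\,\mathcal C(x)=x$ and $\mathbb E\|\mathcal C(x)-x\|^2\le\omega\|x\|^2$ for all $x$ ($\omega\ge 0$). FRECON, with $S\in\{1,\dots,N\}$ clients per round, starts from $x^0$, $h_1^0,\dots,h_N^0$, $h^0=\frac1N\sum_i h^0_i$ and $g^0$ (arbitrary here; the algorithm takes $g^0=0$). In round $t=0,1,2,\dots$ it sets $x^{t+1}=x^t-\eta g^t$, draws $\mathcal S^t$ uniformly among the subsets of $[N]$ of size $S$,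 computes for $i\in\mathcal S^t$ $$q_i^t=\mathcal C\big(\tilde\nabla_b f_i(x^{t+1})-\tilde\nabla_b f_i(x^t)\big),\qquad u_i^t=\mathcal C\big(\tilde\nabla_b f_i(x^t)-h_i^t\big),\qquad h_i^{t+1}=h_i^t+\alpha u_i^t$$ (and $h_j^{t+1}=h_j^t$ for $j\notin\mathcal S^t$), and sets $$g^{t+1}=\tfrac1S\sum_{i\in\mathcal S^t}q_i^t+(1-\lambda)g^t+\lambda\Big(\tfrac1S\sum_{i\in\mathcal S^t}u_i^t+h^t\Big),\qquad h^{t+1}=h^t+\tfrac{\alpha}{N}\sum_{i\in\mathcal S^t}u_i^t .$$ Client sampling, minibatches and compressions are independent over rounds and clients, and the two compressions of a client in a round are independent; the three minibatch gradients that a client computes in one round may be computed from the same or from independent minibatches. There are absolute constants $C_1,C_2>0$ such that the following holds for every $\varepsilon>0$. Let $$\alpha=\frac1{1+\omega},\qquad \lambda=\frac{S}{2(1+\omega)N},\qquad 0<\eta\le\eta_{\max}:=\frac1{L\big(1+\sqrt{10(1+\omega)^2N/S^2}\big)},\qquad b\ge C_1\frac{(1+\omega)^2N\sigma^2}{S^2\varepsilon^2},$$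 with an integer $b\ge1$, and let $$\Phi_0=f(x^0)-f^*+\eta\Big(\frac{(1+\omega)N}{S}\,\|g^0-\nabla f(x^0)\|^2+\frac{1+\omega}{S}\cdot\frac1N\sum_{i=1}^N\|h_i^0-\nabla f_i(x^0)\|^2\Big).$$ Then for every integer $$T\ \ge\ C_2\,\frac{\eta_{\max}}{\eta}\,\Phi_0\Big(\frac{L}{\varepsilon^2}+\frac{L(1+\omega)\sqrt N}{S\varepsilon^2}\Big),\qquad T\ge1,$$ the point $\hat x$ drawn uniformly at random from $x^0,\dots,x^{T-1}$ (independently of the run) satisfies $\mathbb E\|\nabla f(\hat x)\|\le\varepsilon$, i.e. $\frac1T\sum_{t<T}\mathbb E\|\nabla f(x^t)\|\le\varepsilon$, all these expectations being finite. In particular, with $\eta=\eta_{\max}$, FRECON finds a point with $\mathbb E\|\nabla f(x)\|\le\varepsilon$ within $T=O\big(\Phi_0\big(\frac{L}{\varepsilon^2}+\frac{L(1+\omega)\sqrt N}{S\varepsilon^2}\big)\big)$ rounds. -/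

import Mathlib

open MeasureTheory ProbabilityTheory

namespace Frecon

/-- `ℝ^d` with the Euclidean norm. -/
abbrev Vec (d : ℕ) := EuclideanSpace ℝ (Fin d)

noncomputable section

/-- The global objective `f = (1/N) ∑ᵢ fᵢ`. -/
def objective {d N : ℕ} (f : Fin N → Vec d → ℝ) (x : Vec d) : ℝ :=
  (1 / (N : ℝ)) * ∑ i, f i x

/-- Every client function is differentiable with `L`-Lipschitz gradient. -/
structure IsSmoothFamily {d N : ℕ} (L : ℝ) (f : Fin N → Vec d → ℝ) : Prop where
  differentiable : ∀ i, Differentiable ℝ (f i)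
  lipschitz : ∀ i x y, ‖gradient (f i) x - gradient (f i) y‖ ≤ L * ‖x - y‖

/-- `G i x ξ` is the stochastic gradient of client `i` at `x` computed from the data sample `ξ`,
where `ξ` is drawn from the local data distribution `𝒟 i`. It is unbiased for `∇ fᵢ x` and has
local variance at most `σ ^ 2`. -/
structure IsStochasticOracle {d N : ℕ} {D : Type*} [MeasurableSpace D]
    (σ : ℝ) (f : Fin N → Vec d → ℝ) (𝒟 : Fin N → Measure D)
    (G : Fin N → Vec d → D → Vec d) : Prop where
  measurable : ∀ i, Measurable (Function.uncurry (G i))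
  memLp : ∀ i x, MemLp (G i x) 2 (𝒟 i)
  unbiased : ∀ i x, ∫ ξ, G i x ξ ∂(𝒟 i) = gradient (f i) x
  variance_le : ∀ i x, ∫ ξ, ‖G i x ξ - gradient (f i) x‖ ^ 2 ∂(𝒟 i) ≤ σ ^ 2

/-- The randomized map `C` (with random seed `θ` of law `ν`) is an `ω`-compression operator. -/
structure IsCompressor {d : ℕ} {Θ : Type*} [MeasurableSpace Θ]
    (ω : ℝ) (ν : Measure Θ) (C : Θ → Vec d → Vec d) : Prop where
  measurable : Measurable (Function.uncurry C)
  memLp : ∀ x, MemLp (fun θ => C θ x) 2 ν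
  unbiased : ∀ x, ∫ θ, C θ x ∂ν = x
  variance_le : ∀ x, ∫ θ, ‖C θ x - x‖ ^ 2 ∂ν ≤ ω * ‖x‖ ^ 2

/-- The randomness of one communication round: the set of sampled clients; for every client three
minibatches of `b` data samples; for every client two seeds of the compression operator. -/
abbrev RoundNoise (N b : ℕ) (D Θ : Type*) :=
  Finset (Fin N) × (Fin N → Fin 3 → Fin b → D) × (Fin N → Fin 2 → Θ)

/-- The law of the randomness of one round: the client set is uniform among the subsets of size
`S`, the data samples of client `i` have law `𝒟 i`, the seeds have law `ν`, all independent. -/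
def roundLaw (N S b : ℕ) {D Θ : Type*} [MeasurableSpace D] [MeasurableSpace Θ]
    (𝒟 : Fin N → Measure D) (ν : Measure Θ) : Measure (RoundNoise N b D Θ) :=
  (uniformOn {A : Finset (Fin N) | A.card = S}).prod
    ((Measure.pi fun i => Measure.pi fun _ : Fin 3 => Measure.pi fun _ : Fin b => 𝒟 i).prod
      (Measure.pi fun _ : Fin N => Measure.pi fun _ : Fin 2 => ν))

/-- Average of `b` stochastic gradients at `x`. -/
def minibatchGrad {d b : ℕ} {D : Type*} (G : Vec d → D → Vec d) (ξ : Fin b → D) (x : Vec d) :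
    Vec d :=
  (1 / (b : ℝ)) • ∑ j, G x (ξ j)

/-- State at the beginning of a round: model `x`, gradient estimator `g`, local shifts `hLoc i`,
global shift `h`. -/
structure State (d N : ℕ) where
  x : Vec d
  g : Vec d
  hLoc : Fin N → Vec d
  h : Vec d

/-- One round of FRECON. A round uses three minibatch gradients per active client:
number `0` at `x^{t+1}` and number `1` at `x^t`, both inside `q`, and number `2` at `x^t`,
inside `u`. Number `k` is evaluated on the minibatch `reuse k`, so that any two of the three may
be computed from one and the same minibatch or from independent ones. -/
def step {d N b : ℕ} {D Θ : Type*} (S : ℕ) (η α lam : ℝ) (reuse : Fin 3 → Fin 3)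
    (G : Fin N → Vec d → D → Vec d) (C : Θ → Vec d → Vec d)
    (z : RoundNoise N b D Θ) (s : State d N) : State d N :=
  let A : Finset (Fin N) := z.1
  let grad (k : Fin 3) (i : Fin N) (y : Vec d) : Vec d :=
    minibatchGrad (G i) (z.2.1 i (reuse k)) y
  let xNew : Vec d := s.x - η • s.g
  let q (i : Fin N) : Vec d := C (z.2.2 i 0) (grad 0 i xNew - grad 1 i s.x)
  let u (i : Fin N) : Vec d := C (z.2.2 i 1) (grad 2 i s.x - s.hLoc i)
  { x := xNew
    g := (1 / (S : ℝ)) • ∑ i ∈ A, q i + (1 - lam) • s.g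
          + lam • ((1 / (S : ℝ)) • ∑ i ∈ A, u i + s.h)
    hLoc := fun i => if i ∈ A then s.hLoc i + α • u i else s.hLoc i
    h := s.h + (α / (N : ℝ)) • ∑ i ∈ A, u i }

/-- The initial state; `h⁰` is the average of the local shifts. -/
def initState {d N : ℕ} (x₀ g₀ : Vec d) (h₀ : Fin N → Vec d) : State d N :=
  { x := x₀, g := g₀, hLoc := h₀, h := (1 / (N : ℝ)) • ∑ i, h₀ i }

/-- The run of FRECON from state `s₀` when `z t` is the randomness of round `t`. -/
def run {d N b : ℕ} {D Θ : Type*} (S : ℕ) (η α lam : ℝ) (reuse : Fin 3 → Fin 3)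
    (G : Fin N → Vec d → D → Vec d) (C : Θ → Vec d → Vec d) (s₀ : State d N)
    (z : ℕ → RoundNoise N b D Θ) : ℕ → State d N
  | 0 => s₀
  | t + 1 => step S η α lam reuse G C (z t) (run S η α lam reuse G C s₀ z t)

/-- The largest admissible step size `1 / (L (1 + √(10 (1+ω)² N / S²)))`. -/
def maxStep (L ω : ℝ) (N S : ℕ) : ℝ :=
  1 / (L * (1 + Real.sqrt (10 * (1 + ω) ^ 2 * N / (S : ℝ) ^ 2)))

/-- The size of the initial data: initial suboptimality `f(x⁰) - inf f`, plus the initial errors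
of the gradient estimator and of the shifts. -/
def initialPotential {d N : ℕ} (f : Fin N → Vec d → ℝ) (η ω : ℝ) (S : ℕ)
    (x₀ g₀ : Vec d) (h₀ : Fin N → Vec d) : ℝ :=
  (objective f x₀ - ⨅ x, objective f x)
    + η * ((1 + ω) * N / S * ‖g₀ - gradient (objective f) x₀‖ ^ 2
      + (1 + ω) / S * ((1 / (N : ℝ)) * ∑ i, ‖h₀ i - gradient (f i) x₀‖ ^ 2))

end

end Frecon

namespace Frecon

/-! ### Second moments and independence. -/

section Probability

variable {d : ℕ}

/-! Write `A = (1+ω)N/S`, `B = (1+ω)/S`, so that `lam = 1/(2A)`, and let `v = σ²/b`. The argument is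
a Lyapunov one: the potential is `f(x) - inf f` plus `η` times `A` times the squared error of the
estimator `g` plus `B` times the mean squared error of the local shifts. One round lowers its
conditional expectation by at least `η/2 ‖∇f(x)‖²`, up to a noise term `10 η A B v`
(`potential_round`).

Three estimates enter. By `descent`, moving along `-g` lowers `f` up to half of `η` times the
estimator error, and leaves a term `-η/2 ‖g‖²` to spend. In `estimator_error`, the `q` messages
average in expectation to the change of `∇f` and the `u` messages plus `h` to `∇f(x)`, so the bias
of the new estimator is exactly `(1 - lam)(g - ∇f(x))`. The fluctuation is controlled by
`integral_norm_add_sampled_sq_le`: sampling without replacement adds at most `1/(SN)` times the sum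
of the clients' second moments. These involve the distance moved, the shift errors and `v`. In
`shift_error`, a sampled client contracts its shift error by `1 - 1/(1+ω)`; since sampling has
probability `S/N`, the average contraction is `1 - 1/A`, at the price of a drift proportional to
`η²‖g‖²`.

The weights `A` and `B` are chosen so that the errors created by one estimate are paid for by the
contraction of another, and the bound on `η` makes `-η/2 ‖g‖²` pay for all movement terms
(`potential_decrease_arith`). Since the state is independent of the coming round's randomness, the
inequality telescopes over rounds (`sum_lintegral_gradient_le`). The batch size and the number of
rounds then make the averaged squared gradient at most `ε²` (`rate_arith`), and Young's inequality
passes to the unsquared norm. -/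

lemma memLp_two_norm_sq {X : Type*} [MeasurableSpace X] {μ : Measure X} {φ : X → Vec d}
    (hφ : MemLp φ 2 μ) : Integrable (fun x => ‖φ x‖ ^ 2) μ :=
  (memLp_two_iff_integrable_sq_norm hφ.1).1 hφ

lemma integrable_inner_of_memLp {X : Type*} [MeasurableSpace X] {μ : Measure X}
    {φ ψ : X → Vec d} (hφ : MemLp φ 2 μ) (hψ : MemLp ψ 2 μ) :
    Integrable (fun x => inner ℝ (φ x) (ψ x)) μ := by
  refine ((memLp_two_norm_sq hφ).add (memLp_two_norm_sq hψ)).mono'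
    (hφ.1.inner hψ.1) (Filter.Eventually.of_forall fun x => ?_)
  have h1 := abs_real_inner_le_norm (φ x) (ψ x)
  simp only [Real.norm_eq_abs, Pi.add_apply]
  nlinarith [sq_nonneg (‖φ x‖ - ‖ψ x‖), sq_nonneg (‖φ x‖), sq_nonneg ‖ψ x‖]

/-- Bias-variance decomposition of the second moment about `c`. -/
lemma integral_norm_sub_sq {X : Type*} [MeasurableSpace X] {μ : Measure X}
    [IsProbabilityMeasure μ] {φ : X → Vec d} (hφ : MemLp φ 2 μ) (c : Vec d) :
    ∫ x, ‖φ x - c‖ ^ 2 ∂μ = ∫ x, ‖φ x‖ ^ 2 ∂μ - 2 * inner ℝ (∫ x, φ x ∂μ) c + ‖c‖ ^ 2 := by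
  have h1 : Integrable φ μ := hφ.integrable (by norm_num)
  have h2 := memLp_two_norm_sq hφ
  have h3 : Integrable (fun x => inner ℝ (φ x) c) μ := h1.inner_const c
  simp_rw [norm_sub_sq_real]
  have h4 : Integrable (fun x => ‖φ x‖ ^ 2 - 2 * inner ℝ (φ x) c) μ := h2.sub (h3.const_mul 2)
  rw [integral_add h4 (integrable_const _),
    integral_sub h2 (h3.const_mul 2), integral_const_mul]
  have : ∫ x, inner ℝ (φ x) c ∂μ = inner ℝ (∫ x, φ x ∂μ) c := by
    simp_rw [real_inner_comm c]
    rw [integral_inner h1 c]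
  rw [this]; simp

lemma integral_norm_sq_eq {X : Type*} [MeasurableSpace X] {μ : Measure X}
    [IsProbabilityMeasure μ] {φ : X → Vec d} (hφ : MemLp φ 2 μ) {m : Vec d}
    (hm : ∫ x, φ x ∂μ = m) :
    ∫ x, ‖φ x‖ ^ 2 ∂μ = ∫ x, ‖φ x - m‖ ^ 2 ∂μ + ‖m‖ ^ 2 := by
  rw [integral_norm_sub_sq hφ, hm, real_inner_self_eq_norm_sq]; ring

section Pi

variable {ι : Type*} [Fintype ι] {X : ι → Type*} [∀ i, MeasurableSpace (X i)]
  {μ : ∀ i, Measure (X i)} [∀ i, IsProbabilityMeasure (μ i)]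

lemma memLp_eval {φ : ∀ i, X i → Vec d} (i : ι) (h : MemLp (φ i) 2 (μ i)) :
    MemLp (fun z : ∀ i, X i => φ i (z i)) 2 (Measure.pi μ) :=
  h.comp_measurePreserving (measurePreserving_eval μ i)

lemma integral_eval {E : Type*} [NormedAddCommGroup E] [NormedSpace ℝ E] (i : ι) {ψ : X i → E}
    (h : AEStronglyMeasurable ψ (μ i)) :
    ∫ z, ψ (z i) ∂(Measure.pi μ) = ∫ x, ψ x ∂(μ i) := by
  have hp := measurePreserving_eval μ i
  have : ∫ x, ψ x ∂(Measure.map (Function.eval i) (Measure.pi μ)) = _ :=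
    integral_map hp.measurable.aemeasurable (by rwa [hp.map_eq])
  rw [hp.map_eq] at this
  exact this.symm

lemma integral_inner_pi {φ : ∀ i, X i → Vec d} (hφ : ∀ i, MemLp (φ i) 2 (μ i)) {i j : ι}
    (hij : i ≠ j) :
    ∫ z, inner ℝ (φ i (z i)) (φ j (z j)) ∂(Measure.pi μ)
      = inner ℝ (∫ x, φ i x ∂(μ i)) (∫ x, φ j x ∂(μ j)) := by
  have hind : iIndepFun (fun i (z : ∀ i, X i) => φ i (z i)) (Measure.pi μ) :=
    iIndepFun_pi fun i => (hφ i).1.aemeasurable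
  have := (hind.indepFun hij).integral_bilin
    ((memLp_eval i (hφ i)).integrable (by norm_num))
    ((memLp_eval j (hφ j)).integrable (by norm_num))
    (isBoundedBilinearMap_inner (𝕜 := ℝ)).toContinuousLinearMap
  simp only [IsBoundedBilinearMap.toContinuousLinearMap_apply] at this
  rw [this, integral_eval i (hφ i).1, integral_eval j (hφ j).1]

/-- The second moment of a sum of independent centered vectors. -/
lemma integral_norm_sum_sq_pi {φ : ∀ i, X i → Vec d} (hφ : ∀ i, MemLp (φ i) 2 (μ i))
    (h0 : ∀ i, ∫ x, φ i x ∂(μ i) = 0) :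
    ∫ z, ‖∑ i, φ i (z i)‖ ^ 2 ∂(Measure.pi μ) = ∑ i, ∫ x, ‖φ i x‖ ^ 2 ∂(μ i) := by
  classical
  simp_rw [← real_inner_self_eq_norm_sq, sum_inner, inner_sum]
  rw [integral_finsetSum _ fun i _ => integrable_finsetSum _ fun j _ =>
    integrable_inner_of_memLp (memLp_eval i (hφ i)) (memLp_eval j (hφ j))]
  refine Finset.sum_congr rfl fun i _ => ?_
  rw [integral_finsetSum _ fun j _ =>
    integrable_inner_of_memLp (memLp_eval i (hφ i)) (memLp_eval j (hφ j))]
  rw [Finset.sum_eq_single i]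
  · exact integral_eval (ψ := fun x => inner ℝ (φ i x) (φ i x)) i ((hφ i).1.inner (hφ i).1)
  · intro j _ hj
    rw [integral_inner_pi hφ hj.symm, h0, inner_zero_left]
  · simp

end Pi

/-! ### Inclusion probabilities of uniform sampling without replacement. -/

section Sampling

variable {N S : ℕ}

/-- The law of the set of sampled clients. -/
noncomputable abbrev sampleLaw (N S : ℕ) : Measure (Finset (Fin N)) :=
  uniformOn {A : Finset (Fin N) | A.card = S}

lemma coe_powersetCard_univ :
    ((Finset.powersetCard S (Finset.univ : Finset (Fin N)) : Finset (Finset (Fin N))) :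
      Set (Finset (Fin N))) = {A | A.card = S} := by
  ext A; simp [Finset.mem_powersetCard]

lemma isProbabilityMeasure_sampleLaw (h : S ≤ N) : IsProbabilityMeasure (sampleLaw N S) := by
  refine isProbabilityMeasure_uniformOn (Set.toFinite _) ?_
  rw [← coe_powersetCard_univ, Finset.coe_nonempty, Finset.powersetCard_nonempty]
  simpa using h

/-- Indicator that client `i` is sampled. -/
noncomputable def active (A : Finset (Fin N)) (i : Fin N) : ℝ := if i ∈ A then 1 else 0

lemma sampleLaw_real_subset (B : Finset (Fin N)) (hB : B.card ≤ S) :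
    (sampleLaw N S).real {A | B ⊆ A}
      = ((N - B.card).choose (S - B.card) : ℝ) / (N.choose S : ℝ) := by
  classical
  have h1 : ({A | B ⊆ A} : Set (Finset (Fin N)))
      = ((Finset.univ.filter (B ⊆ ·) : Finset (Finset (Fin N))) : Set _) := by ext; simp
  rw [Measure.real, h1, sampleLaw, ← coe_powersetCard_univ, uniformOn_apply_finset,
    Finset.inter_filter, Finset.inter_univ,
    Finset.card_filter_powersetCard_subset _ _ _ (Finset.subset_univ B) hB]
  simp

lemma integral_active (h1 : 1 ≤ S) (h2 : S ≤ N) (i : Fin N) :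
    ∫ A, active A i ∂(sampleLaw N S) = (S : ℝ) / N := by
  have e : (fun A : Finset (Fin N) => active A i)
      = Set.indicator {A | {i} ⊆ A} (fun _ => (1 : ℝ)) := by
    ext A; simp [active, Set.indicator]
  rw [e, integral_indicator_const _ (Set.toFinite _).measurableSet,
    sampleLaw_real_subset _ (by simpa using h1)]
  obtain ⟨s, rfl⟩ := Nat.exists_eq_add_of_le' h1
  obtain ⟨n, rfl⟩ := Nat.exists_eq_add_of_le' (h1.trans h2)
  have hc := Nat.add_one_mul_choose_eq n s
  have hpos : 0 < (n + 1).choose (s + 1) := Nat.choose_pos h2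
  simp only [Finset.card_singleton, Nat.add_sub_cancel, smul_eq_mul, mul_one]
  rw [div_eq_div_iff (by positivity) (by positivity)]
  have : ((n : ℝ) + 1) * n.choose s = (n + 1).choose (s + 1) * (s + 1) := by exact_mod_cast hc
  push_cast; linarith

/-- Inclusions of distinct clients are nonpositively correlated: for `S ≥ 2` the pair probability is
`S(S-1)/(N(N-1))`, and `(S-1)/(N-1) ≤ S/N`. Only this bound and the fact that the value is the same
for all pairs matter later, hence the existential. -/
lemma integral_active_mul (h1 : 1 ≤ S) (h2 : S ≤ N) :
    ∃ κ : ℝ, 0 ≤ κ ∧ κ ≤ (S / N : ℝ) ^ 2 ∧ ∀ i j : Fin N, i ≠ j →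
      ∫ A, active A i * active A j ∂(sampleLaw N S) = κ := by
  classical
  have key : ∀ i j : Fin N, i ≠ j → ∫ A, active A i * active A j ∂(sampleLaw N S)
      = (sampleLaw N S).real {A | {i, j} ⊆ A} := by
    intro i j _
    have e : (fun A : Finset (Fin N) => active A i * active A j)
        = Set.indicator {A | {i, j} ⊆ A} (fun _ => (1 : ℝ)) := by
      ext A
      by_cases hi : i ∈ A <;> by_cases hj : j ∈ A <;>
        simp [active, Set.indicator, Finset.insert_subset_iff, hi, hj]
    rw [e, integral_indicator_const _ (Set.toFinite _).measurableSet]; simp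
  -- For `S = 1` no pair is ever sampled, whereas the binomial formula with truncated `S - 2` would
  -- give a positive value.
  rcases Nat.lt_or_ge S 2 with hS | hS
  · obtain rfl : S = 1 := by omega
    refine ⟨0, le_rfl, by positivity, fun i j hij => ?_⟩
    rw [key i j hij, measureReal_def]
    have : sampleLaw N 1 {A | {i, j} ⊆ A} = 0 := by
      rw [uniformOn_eq_zero_iff (Set.toFinite _)]
      ext A
      simp only [Set.mem_inter_iff, Set.mem_ofPred_eq, Set.mem_empty_iff_false, iff_false, not_and]
      intro hA hs
      have := Finset.card_le_card hs
      rw [Finset.card_pair hij] at this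
      omega
    rw [this]; simp
  · refine ⟨((N - 2).choose (S - 2) : ℝ) / (N.choose S : ℝ), by positivity, ?_, fun i j hij => ?_⟩
    · obtain ⟨s, rfl⟩ := Nat.exists_eq_add_of_le' hS
      obtain ⟨n, rfl⟩ := Nat.exists_eq_add_of_le' (hS.trans h2)
      have hc1 := Nat.add_one_mul_choose_eq n s
      have hc2 := Nat.add_one_mul_choose_eq (n + 1) (s + 1)
      have hsn : (s : ℝ) ≤ n := by exact_mod_cast Nat.le_of_add_le_add_right h2
      have hpos : (0 : ℝ) < (n + 2).choose (s + 2) := by exact_mod_cast Nat.choose_pos h2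
      have e1 : ((n : ℝ) + 1) * n.choose s = (n + 1).choose (s + 1) * (s + 1) := by
        exact_mod_cast hc1
      have e2 : ((n : ℝ) + 2) * (n + 1).choose (s + 1) = (n + 2).choose (s + 2) * (s + 2) := by
        exact_mod_cast hc2
      simp only [Nat.add_sub_cancel]
      rw [div_le_iff₀ hpos, div_pow, div_mul_eq_mul_div, le_div_iff₀ (by positivity)]
      push_cast
      have hs0 : (0 : ℝ) ≤ s := by positivity
      set a : ℝ := (n.choose s : ℝ)
      set b' : ℝ := ((n + 1).choose (s + 1) : ℝ)
      set c : ℝ := ((n + 2).choose (s + 2) : ℝ)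
      have hn1 : (0 : ℝ) < n + 1 := by positivity
      have hab : ((n : ℝ) + 2) * a ≤ b' * (s + 2) := by
        have ha : a = b' * (s + 1) / (n + 1) := by field_simp; linarith
        have hb : 0 ≤ b' := by positivity
        rw [ha, ← mul_div_assoc, div_le_iff₀ hn1]
        nlinarith [mul_nonneg hb (sub_nonneg.2 hsn)]
      nlinarith [mul_le_mul_of_nonneg_left hab (show (0 : ℝ) ≤ n + 2 by positivity)]
    · rw [key i j hij, sampleLaw_real_subset _ (by rw [Finset.card_pair hij]; exact hS),
        Finset.card_pair hij]

end Sampling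

end Probability

end Frecon

namespace Frecon

/-! ### Averages of independent client messages over the sampled set. -/

section SampledSum

variable {d N S : ℕ} {X : Type*} [MeasurableSpace X] {ρ : Fin N → Measure X}
  [∀ i, IsProbabilityMeasure (ρ i)]

lemma sum_mem_eq_sum_active (A : Finset (Fin N)) (y : Fin N → Vec d) :
    ∑ i ∈ A, y i = ∑ i, active A i • y i := by
  simp [active, ite_smul, Finset.sum_ite_mem]

lemma active_mul_self (A : Finset (Fin N)) (i : Fin N) : active A i * active A i = active A i := by
  simp [active]

lemma norm_add_sampled_sq (A : Finset (Fin N)) (c : Vec d) (y : Fin N → Vec d) :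
    ‖c + (1 / (S : ℝ)) • ∑ i ∈ A, y i‖ ^ 2
      = ‖c‖ ^ 2 + 2 / (S : ℝ) * ∑ i, active A i * inner ℝ c (y i)
        + 1 / (S : ℝ) ^ 2 * ∑ i, ∑ j, (active A i * active A j) * inner ℝ (y i) (y j) := by
  rw [sum_mem_eq_sum_active, norm_add_sq_real, inner_smul_right, inner_sum, norm_smul, mul_pow,
    ← real_inner_self_eq_norm_sq (∑ i, _ : Vec d), sum_inner]
  simp_rw [inner_sum, real_inner_smul_left, real_inner_smul_right]
  simp only [Real.norm_eq_abs, sq_abs, mul_assoc, div_eq_mul_inv]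
  ring

/-- Here `κ` is the pair inclusion probability, `M` the squared norm of the sum of the means, `V`
the sum of their squared norms and `E` the sum of second moments. The bound `κ ≤ (s/n)²` compares
the `M` terms, and the diagonal correction `-κ V` is discarded. -/
lemma sampled_second_moment_arith {s n κ M V : ℝ} (hs : 0 < s) (hn : 0 < n) (hκ0 : 0 ≤ κ)
    (hκ : κ ≤ (s / n) ^ 2) (hM : 0 ≤ M) (hV : 0 ≤ V) (c I E : ℝ) :
    c + 2 / s * (s / n * I) + 1 / s ^ 2 * (κ * M + (s / n * E - κ * V))
      ≤ c + 2 * (1 / n * I) + (1 / n) ^ 2 * M + 1 / (s * n) * E := by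
  have a1 : 1 / s ^ 2 * (κ * M) ≤ (1 / n) ^ 2 * M := by
    rw [← mul_assoc]
    refine mul_le_mul_of_nonneg_right ?_ hM
    calc 1 / s ^ 2 * κ ≤ 1 / s ^ 2 * (s / n) ^ 2 := by gcongr
      _ = _ := by field_simp
  have a2 : 0 ≤ 1 / s ^ 2 * (κ * V) := by positivity
  have a3 : 1 / s ^ 2 * (s / n * E) = 1 / (s * n) * E := by field_simp
  have a4 : 2 / s * (s / n * I) = 2 * (1 / n * I) := by field_simp
  rw [mul_add, mul_sub, a3, a4]
  linarith

/-- Second moment of an average over `S` clients sampled without replacement. -/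
lemma integral_norm_add_sampled_sq_le (h1 : 1 ≤ S) (h2 : S ≤ N) {Y : Fin N → X → Vec d}
    (hY : ∀ i, MemLp (Y i) 2 (ρ i)) (c : Vec d) :
    Integrable (fun p : Finset (Fin N) × (Fin N → X) =>
        ‖c + (1 / (S : ℝ)) • ∑ i ∈ p.1, Y i (p.2 i)‖ ^ 2)
      ((sampleLaw N S).prod (Measure.pi ρ)) ∧
    ∫ p, ‖c + (1 / (S : ℝ)) • ∑ i ∈ p.1, Y i (p.2 i)‖ ^ 2 ∂((sampleLaw N S).prod (Measure.pi ρ))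
      ≤ ‖c + (1 / (N : ℝ)) • ∑ i, ∫ x, Y i x ∂(ρ i)‖ ^ 2
        + 1 / ((S : ℝ) * N) * ∑ i, ∫ x, ‖Y i x‖ ^ 2 ∂(ρ i) := by
  classical
  have := isProbabilityMeasure_sampleLaw h2
  set m : Fin N → Vec d := fun i => ∫ x, Y i x ∂(ρ i) with hm
  have hS : (0 : ℝ) < S := by exact_mod_cast h1
  have hN : (0 : ℝ) < N := by exact_mod_cast h1.trans h2
  have i1 : ∀ i, Integrable (fun z : Fin N → X => inner ℝ c (Y i (z i))) (Measure.pi ρ) :=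
    fun i => ((memLp_eval i (hY i)).integrable (by norm_num)).const_inner c
  have i2 : ∀ i j, Integrable (fun z : Fin N → X => inner ℝ (Y i (z i)) (Y j (z j)))
      (Measure.pi ρ) := fun i j => integrable_inner_of_memLp (memLp_eval i (hY i))
        (memLp_eval j (hY j))
  have j1 : ∀ i, Integrable (fun p : Finset (Fin N) × (Fin N → X) =>
      active p.1 i * inner ℝ c (Y i (p.2 i))) ((sampleLaw N S).prod (Measure.pi ρ)) :=
    fun i => Integrable.mul_prod (f := fun A => active A i) Integrable.of_finite (i1 i)
  have j2 : ∀ i j, Integrable (fun p : Finset (Fin N) × (Fin N → X) =>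
      (active p.1 i * active p.1 j) * inner ℝ (Y i (p.2 i)) (Y j (p.2 j)))
      ((sampleLaw N S).prod (Measure.pi ρ)) :=
    fun i j => Integrable.mul_prod (f := fun A => active A i * active A j)
      Integrable.of_finite (i2 i j)
  have k1 : Integrable (fun p : Finset (Fin N) × (Fin N → X) =>
      2 / (S : ℝ) * ∑ i, active p.1 i * inner ℝ c (Y i (p.2 i)))
      ((sampleLaw N S).prod (Measure.pi ρ)) :=
    (integrable_finsetSum _ fun i _ => j1 i).const_mul _
  have k2' : ∀ i, Integrable (fun p : Finset (Fin N) × (Fin N → X) =>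
      ∑ j, (active p.1 i * active p.1 j) * inner ℝ (Y i (p.2 i)) (Y j (p.2 j)))
      ((sampleLaw N S).prod (Measure.pi ρ)) :=
    fun i => integrable_finsetSum _ fun j _ => j2 i j
  have k2 : Integrable (fun p : Finset (Fin N) × (Fin N → X) =>
      1 / (S : ℝ) ^ 2 * ∑ i, ∑ j,
        (active p.1 i * active p.1 j) * inner ℝ (Y i (p.2 i)) (Y j (p.2 j)))
      ((sampleLaw N S).prod (Measure.pi ρ)) :=
    (integrable_finsetSum _ fun i _ => k2' i).const_mul _
  have k0 : Integrable (fun p : Finset (Fin N) × (Fin N → X) =>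
      ‖c‖ ^ 2 + 2 / (S : ℝ) * ∑ i, active p.1 i * inner ℝ c (Y i (p.2 i)))
      ((sampleLaw N S).prod (Measure.pi ρ)) := (integrable_const _).add k1
  obtain ⟨R, hR⟩ : ∃ R, ‖c + (1 / (N : ℝ)) • ∑ i, m i‖ ^ 2 = R := ⟨_, rfl⟩
  rw [hR]
  simp_rw [norm_add_sampled_sq]
  refine ⟨k0.add k2, ?_⟩
  obtain ⟨κ, hκ0, hκ1, hκ⟩ := integral_active_mul (N := N) h1 h2
  have e1 : ∀ i, ∫ p, active p.1 i * inner ℝ c (Y i (p.2 i))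
      ∂((sampleLaw N S).prod (Measure.pi ρ)) = (S : ℝ) / N * inner ℝ c (m i) := by
    intro i
    rw [integral_prod_mul (fun A => active A i) (fun z : Fin N → X => inner ℝ c (Y i (z i))),
      integral_active h1 h2, integral_inner ((memLp_eval i (hY i)).integrable (by norm_num)),
      integral_eval i (hY i).1]
  -- The diagonal is written as the off-diagonal value plus a correction, so that the double sum
  -- collapses to `κ ‖∑ m i‖²` plus a single sum.
  have e2 : ∀ i j, ∫ p, (active p.1 i * active p.1 j) * inner ℝ (Y i (p.2 i)) (Y j (p.2 j))
      ∂((sampleLaw N S).prod (Measure.pi ρ))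
      = κ * inner ℝ (m i) (m j) + if i = j then
        (S : ℝ) / N * ∫ x, ‖Y i x‖ ^ 2 ∂(ρ i) - κ * ‖m i‖ ^ 2 else 0 := by
    intro i j
    rw [integral_prod_mul (fun A => active A i * active A j)
      (fun z : Fin N → X => inner ℝ (Y i (z i)) (Y j (z j)))]
    by_cases hij : i = j
    · subst hij
      simp_rw [active_mul_self, real_inner_self_eq_norm_sq]
      rw [integral_active h1 h2,
        integral_eval (μ := ρ) (ψ := fun x => ‖Y i x‖ ^ 2) i (memLp_two_norm_sq (hY i)).1]
      simp
    · rw [hκ i j hij, integral_inner_pi hY hij]; simp [hij, hm]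
  rw [integral_add k0 k2, integral_add (integrable_const _) k1, integral_const_mul,
    integral_const_mul, integral_finsetSum _ fun i _ => j1 i,
    integral_finsetSum _ fun i _ => k2' i,
    Finset.sum_congr rfl fun i _ => integral_finsetSum _ fun j _ => j2 i j]
  simp_rw [e1, e2]
  simp only [Finset.sum_add_distrib, Finset.sum_ite_eq, Finset.mem_univ, if_true,
    Finset.sum_sub_distrib, ← Finset.mul_sum, ← inner_sum, ← sum_inner]
  rw [← hR, norm_add_sq_real, inner_smul_right, norm_smul, mul_pow, real_inner_self_eq_norm_sq]
  simp only [integral_const, probReal_univ, smul_eq_mul, one_mul, Real.norm_eq_abs, sq_abs]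
  exact sampled_second_moment_arith hS hN hκ0 hκ1 (by positivity)
    (Finset.sum_nonneg fun i _ => by positivity) _ _ _

/-- Inclusion of client `i` is independent of its message and has probability `S/N`; rewriting the
conditional as an indicator times `a - b`, plus `b`, factors the integral. -/
lemma integral_sampled_ite (h1 : 1 ≤ S) (h2 : S ≤ N) (i : Fin N) {a : X → ℝ}
    (ha : Integrable a (ρ i)) (b : ℝ) :
    Integrable (fun p : Finset (Fin N) × (Fin N → X) => if i ∈ p.1 then a (p.2 i) else b)
      ((sampleLaw N S).prod (Measure.pi ρ)) ∧
    ∫ p, (if i ∈ p.1 then a (p.2 i) else b) ∂((sampleLaw N S).prod (Measure.pi ρ))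
      = (S : ℝ) / N * ∫ x, a x ∂(ρ i) + (1 - (S : ℝ) / N) * b := by
  have := isProbabilityMeasure_sampleLaw h2
  have hrw : ∀ p : Finset (Fin N) × (Fin N → X), (if i ∈ p.1 then a (p.2 i) else b)
      = active p.1 i * (a (p.2 i) - b) + b := by
    intro p; by_cases h : i ∈ p.1 <;> simp [active, h]
  simp_rw [hrw]
  have ha' : Integrable (fun z : Fin N → X => a (z i)) (Measure.pi ρ) :=
    (measurePreserving_eval ρ i).integrable_comp_of_integrable ha
  have hi : Integrable (fun z : Fin N → X => a (z i) - b) (Measure.pi ρ) :=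
    ha'.sub (integrable_const b)
  have hp : Integrable (fun p : Finset (Fin N) × (Fin N → X) => active p.1 i * (a (p.2 i) - b))
      ((sampleLaw N S).prod (Measure.pi ρ)) :=
    Integrable.mul_prod (f := fun A => active A i) Integrable.of_finite hi
  refine ⟨hp.add (integrable_const b), ?_⟩
  rw [integral_add hp (integrable_const b),
    integral_prod_mul (fun A => active A i) (fun z : Fin N → X => a (z i) - b),
    integral_active h1 h2, integral_sub ha' (integrable_const b), integral_eval i ha.1]
  simp; ring

end SampledSum

/-! ### Moments of the messages sent by one client. -/

section Client

variable {d N b : ℕ} {D Θ : Type*} [MeasurableSpace D] [MeasurableSpace Θ]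

lemma IsCompressor.comp_eval {ω : ℝ} {ν : Measure Θ} [IsProbabilityMeasure ν]
    {C : Θ → Vec d → Vec d} (hC : IsCompressor ω ν C) {κ : Type*} [Fintype κ] (k : κ) :
    IsCompressor ω (Measure.pi fun _ : κ => ν) (fun θ => C (θ k)) where
  measurable := by
    have h : Measurable (fun p : (κ → Θ) × Vec d => (p.1 k, p.2)) := by fun_prop
    exact hC.measurable.comp h
  memLp x := memLp_eval (φ := fun (_ : κ) θ => C θ x) k (hC.memLp x)
  unbiased x := by
    rw [integral_eval (μ := fun _ : κ => ν) (ψ := fun θ => C θ x) k (hC.memLp x).1, hC.unbiased]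
  variance_le x := by
    rw [integral_eval (μ := fun _ : κ => ν) (ψ := fun θ => ‖C θ x - x‖ ^ 2) k
      (((hC.memLp x).1.sub aestronglyMeasurable_const).norm.pow 2)]
    exact hC.variance_le x

lemma IsCompressor.second_moment_le {ω : ℝ} {ν : Measure Θ} [IsProbabilityMeasure ν]
    {C : Θ → Vec d → Vec d} (hC : IsCompressor ω ν C) (v : Vec d) :
    ∫ θ, ‖C θ v‖ ^ 2 ∂ν ≤ (1 + ω) * ‖v‖ ^ 2 := by
  rw [integral_norm_sq_eq (hC.memLp v) (hC.unbiased v)]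
  linarith [hC.variance_le v]

/-- Compressing an independent square-integrable vector preserves the mean and increases the
second moment at most by the factor `1 + ω`. -/
lemma IsCompressor.compress {ω : ℝ} {ν : Measure Θ} [IsProbabilityMeasure ν]
    {C : Θ → Vec d → Vec d} (hC : IsCompressor ω ν C) {X : Type*} [MeasurableSpace X]
    {μ : Measure X} [IsProbabilityMeasure μ] {a : X → Vec d} (ha : MemLp a 2 μ) :
    MemLp (fun z : X × Θ => C z.2 (a z.1)) 2 (μ.prod ν) ∧
    ∫ z, C z.2 (a z.1) ∂(μ.prod ν) = ∫ x, a x ∂μ ∧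
    ∫ z, ‖C z.2 (a z.1)‖ ^ 2 ∂(μ.prod ν) ≤ (1 + ω) * ∫ x, ‖a x‖ ^ 2 ∂μ := by
  have hm : AEStronglyMeasurable (fun z : X × Θ => C z.2 (a z.1)) (μ.prod ν) := by
    refine (hC.measurable.comp_aemeasurable (AEMeasurable.prodMk measurable_snd.aemeasurable
      ?_)).aestronglyMeasurable
    exact ha.1.aemeasurable.comp_quasiMeasurePreserving Measure.quasiMeasurePreserving_fst
  have hsq := (memLp_two_norm_sq ha).const_mul (1 + ω)
  have hint : Integrable (fun z : X × Θ => ‖C z.2 (a z.1)‖ ^ 2) (μ.prod ν) := by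
    have hm2 : AEStronglyMeasurable (fun z : X × Θ => ‖C z.2 (a z.1)‖ ^ 2) (μ.prod ν) :=
      hm.norm.pow 2
    rw [integrable_prod_iff hm2]
    refine ⟨Filter.Eventually.of_forall fun x => memLp_two_norm_sq (hC.memLp (a x)), ?_⟩
    refine hsq.mono' hm2.norm.integral_prod_right' ?_
    refine Filter.Eventually.of_forall fun x => ?_
    -- Integrability over the product follows from that of `‖a‖²`, since for fixed `x` the second
    -- moment over the seed is at most `(1 + ω)‖a x‖²`.
    simp only [norm_pow, norm_norm]
    rw [Real.norm_of_nonneg (integral_nonneg fun _ => by positivity)]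
    exact hC.second_moment_le _
  have hL : MemLp (fun z : X × Θ => C z.2 (a z.1)) 2 (μ.prod ν) :=
    (memLp_two_iff_integrable_sq_norm hm).2 hint
  refine ⟨hL, ?_, ?_⟩
  · rw [integral_prod _ (hL.integrable (by norm_num))]
    simp only [hC.unbiased]
  · rw [integral_prod _ hint, ← integral_const_mul]
    have hpt : ∀ x, ∫ θ, ‖C θ (a x)‖ ^ 2 ∂ν ≤ (1 + ω) * ‖a x‖ ^ 2 :=
      fun x => hC.second_moment_le (a x)
    exact integral_mono_of_nonneg
      (Filter.Eventually.of_forall fun x => integral_nonneg fun _ => by positivity) hsq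
      (Filter.Eventually.of_forall hpt)

variable {σ : ℝ} {f : Fin N → Vec d → ℝ} {𝒟 : Fin N → Measure D}
  [∀ i, IsProbabilityMeasure (𝒟 i)] {G : Fin N → Vec d → D → Vec d}

lemma IsStochasticOracle.minibatch (hG : IsStochasticOracle σ f 𝒟 G) (hb : 1 ≤ b) (i : Fin N)
    (x : Vec d) :
    MemLp (fun ξ : Fin b → D => minibatchGrad (G i) ξ x) 2 (Measure.pi fun _ => 𝒟 i) ∧
    ∫ ξ : Fin b → D, minibatchGrad (G i) ξ x ∂(Measure.pi fun _ => 𝒟 i) = gradient (f i) x ∧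
    ∫ ξ : Fin b → D, ‖minibatchGrad (G i) ξ x - gradient (f i) x‖ ^ 2 ∂(Measure.pi fun _ => 𝒟 i)
      ≤ σ ^ 2 / b := by
  have hb' : (0 : ℝ) < b := by exact_mod_cast hb
  have h1 : ∀ j : Fin b, MemLp (fun ξ : Fin b → D => G i x (ξ j)) 2 (Measure.pi fun _ => 𝒟 i) :=
    fun j => memLp_eval (φ := fun _ ξ => G i x ξ) j (hG.memLp i x)
  have h2 : MemLp (fun ξ : Fin b → D => (1 / (b : ℝ)) • ∑ j, G i x (ξ j)) 2
      (Measure.pi fun _ => 𝒟 i) :=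
    (memLp_finsetSum Finset.univ fun j _ => h1 j).const_smul (1 / (b : ℝ))
  refine ⟨h2, ?_, ?_⟩
  · unfold minibatchGrad
    rw [integral_smul, integral_finsetSum _ fun j _ => (h1 j).integrable (by norm_num)]
    simp_rw [fun j : Fin b => integral_eval (μ := fun _ : Fin b => 𝒟 i) (ψ := fun ξ => G i x ξ) j
      (hG.memLp i x).1, hG.unbiased]
    rw [Finset.sum_const, Finset.card_univ, Fintype.card_fin, ← Nat.cast_smul_eq_nsmul ℝ,
      smul_smul, one_div, inv_mul_cancel₀ hb'.ne', one_smul]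
  · have e : ∀ ξ : Fin b → D, ‖minibatchGrad (G i) ξ x - gradient (f i) x‖ ^ 2
        = (1 / (b : ℝ)) ^ 2 * ‖∑ j, (G i x (ξ j) - gradient (f i) x)‖ ^ 2 := by
      intro ξ
      have : minibatchGrad (G i) ξ x - gradient (f i) x
          = (1 / (b : ℝ)) • ∑ j, (G i x (ξ j) - gradient (f i) x) := by
        rw [minibatchGrad, Finset.sum_sub_distrib, smul_sub, Finset.sum_const, Finset.card_univ,
          Fintype.card_fin, ← Nat.cast_smul_eq_nsmul ℝ, smul_smul, one_div,
          inv_mul_cancel₀ hb'.ne', one_smul]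
      rw [this, norm_smul, mul_pow, Real.norm_eq_abs, sq_abs]
    simp_rw [e]
    rw [integral_const_mul, integral_norm_sum_sq_pi (μ := fun _ : Fin b => 𝒟 i)
      (φ := fun _ ξ => G i x ξ - gradient (f i) x)
      (fun _ => (hG.memLp i x).sub (memLp_const _))]
    · calc (1 / (b : ℝ)) ^ 2 * ∑ _j : Fin b, ∫ ξ, ‖G i x ξ - gradient (f i) x‖ ^ 2 ∂(𝒟 i)
          ≤ (1 / (b : ℝ)) ^ 2 * ∑ _j : Fin b, σ ^ 2 := by
            gcongr; exact hG.variance_le i x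
        _ = σ ^ 2 / b := by simp; field_simp
    · intro _
      rw [integral_sub ((hG.memLp i x).integrable (by norm_num)) (integrable_const _),
        hG.unbiased]
      simp

/-- `minibatch` for one of several independent minibatches. -/
lemma IsStochasticOracle.minibatch_eval (hG : IsStochasticOracle σ f 𝒟 G) (hb : 1 ≤ b)
    (i : Fin N) (x : Vec d) (k : Fin 3) :
    MemLp (fun ξ : Fin 3 → Fin b → D => minibatchGrad (G i) (ξ k) x) 2
      (Measure.pi fun _ => Measure.pi fun _ => 𝒟 i) ∧
    ∫ ξ : Fin 3 → Fin b → D, minibatchGrad (G i) (ξ k) x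
      ∂(Measure.pi fun _ => Measure.pi fun _ => 𝒟 i) = gradient (f i) x ∧
    ∫ ξ : Fin 3 → Fin b → D, ‖minibatchGrad (G i) (ξ k) x - gradient (f i) x‖ ^ 2
      ∂(Measure.pi fun _ => Measure.pi fun _ => 𝒟 i) ≤ σ ^ 2 / b := by
  obtain ⟨h1, h2, h3⟩ := hG.minibatch hb i x
  refine ⟨memLp_eval (φ := fun _ ξ => minibatchGrad (G i) ξ x) k h1, ?_, ?_⟩
  · rw [integral_eval (μ := fun _ : Fin 3 => Measure.pi fun _ : Fin b => 𝒟 i)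
      (ψ := fun ξ => minibatchGrad (G i) ξ x) k h1.1, h2]
  · rw [integral_eval (μ := fun _ : Fin 3 => Measure.pi fun _ : Fin b => 𝒟 i)
      (ψ := fun ξ => ‖minibatchGrad (G i) ξ x - gradient (f i) x‖ ^ 2) k
      ((h1.1.sub aestronglyMeasurable_const).norm.pow 2)]
    exact h3

/-- The randomness of one client in one round. -/
abbrev ClientNoise (b : ℕ) (D Θ : Type*) := (Fin 3 → Fin b → D) × (Fin 2 → Θ)

/-- The law of the randomness of client `i` in one round. -/
noncomputable abbrev clientLaw (b : ℕ) (𝒟 : Fin N → Measure D) (ν : Measure Θ) (i : Fin N) :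
    Measure (ClientNoise b D Θ) :=
  (Measure.pi fun _ : Fin 3 => Measure.pi fun _ : Fin b => 𝒟 i).prod
    (Measure.pi fun _ : Fin 2 => ν)

/-- The compressed gradient difference of client `i` between `x` and `y`. -/
noncomputable def qMsg (reuse : Fin 3 → Fin 3) (G : Fin N → Vec d → D → Vec d)
    (C : Θ → Vec d → Vec d) (x y : Vec d) (i : Fin N) (z : ClientNoise b D Θ) : Vec d :=
  C (z.2 0) (minibatchGrad (G i) (z.1 (reuse 0)) y - minibatchGrad (G i) (z.1 (reuse 1)) x)

/-- The compressed shifted gradient of client `i` at `x` with shift `h`. -/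
noncomputable def uMsg (reuse : Fin 3 → Fin 3) (G : Fin N → Vec d → D → Vec d)
    (C : Θ → Vec d → Vec d) (x h : Vec d) (i : Fin N) (z : ClientNoise b D Θ) : Vec d :=
  C (z.2 1) (minibatchGrad (G i) (z.1 (reuse 2)) x - h)

variable {ω : ℝ} {ν : Measure Θ} [IsProbabilityMeasure ν] {C : Θ → Vec d → Vec d}

lemma norm_add_sq_le_two (a b : Vec d) : ‖a + b‖ ^ 2 ≤ 2 * ‖a‖ ^ 2 + 2 * ‖b‖ ^ 2 := by
  have h := parallelogram_law_with_norm ℝ a b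
  nlinarith [sq_nonneg ‖a - b‖]

/-- The two minibatch gradients may share their samples, so no independence between them is invoked:
the deviations are split by `‖a + b‖² ≤ 2‖a‖² + 2‖b‖²`, which gives `4 σ²/b` for every choice of
`reuse`. -/
lemma qMsg_moments (hG : IsStochasticOracle σ f 𝒟 G) (hC : IsCompressor ω ν C) (hω : 0 ≤ ω)
    (hb : 1 ≤ b) (reuse : Fin 3 → Fin 3) (x y : Vec d) (i : Fin N) :
    MemLp (qMsg (b := b) reuse G C x y i) 2 (clientLaw b 𝒟 ν i) ∧
    ∫ z, qMsg (b := b) reuse G C x y i z ∂(clientLaw b 𝒟 ν i)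
      = gradient (f i) y - gradient (f i) x ∧
    ∫ z, ‖qMsg (b := b) reuse G C x y i z‖ ^ 2 ∂(clientLaw b 𝒟 ν i)
      ≤ (1 + ω) * (‖gradient (f i) y - gradient (f i) x‖ ^ 2 + 4 * (σ ^ 2 / b)) := by
  obtain ⟨a1, a2, a3⟩ := hG.minibatch_eval hb i y (reuse 0)
  obtain ⟨b1, b2, b3⟩ := hG.minibatch_eval hb i x (reuse 1)
  have hm : ∫ ξ : Fin 3 → Fin b → D, (minibatchGrad (G i) (ξ (reuse 0)) y
      - minibatchGrad (G i) (ξ (reuse 1)) x) ∂(Measure.pi fun _ => Measure.pi fun _ => 𝒟 i)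
      = gradient (f i) y - gradient (f i) x := by
    rw [integral_sub (a1.integrable (by norm_num)) (b1.integrable (by norm_num)), a2, b2]
  obtain ⟨c1, c2, c3⟩ := (hC.comp_eval (0 : Fin 2)).compress (a1.sub b1)
  refine ⟨c1, c2.trans hm, c3.trans (mul_le_mul_of_nonneg_left ?_ (by linarith))⟩
  have hs := integral_norm_sq_eq (a1.sub b1) hm
  simp only [Pi.sub_apply] at hs ⊢
  rw [hs, add_comm]
  gcongr
  have ia := memLp_two_norm_sq (a1.sub (memLp_const (gradient (f i) y)))
  have ib := memLp_two_norm_sq (b1.sub (memLp_const (gradient (f i) x)))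
  have iab := (ia.const_mul 2).add (ib.const_mul 2)
  have hle := integral_mono_of_nonneg (Filter.Eventually.of_forall fun ξ => by positivity) iab
    (Filter.Eventually.of_forall fun ξ : Fin 3 → Fin b → D =>
    show ‖minibatchGrad (G i) (ξ (reuse 0)) y - minibatchGrad (G i) (ξ (reuse 1)) x
        - (gradient (f i) y - gradient (f i) x)‖ ^ 2 ≤ _ by
      have := norm_add_sq_le_two (minibatchGrad (G i) (ξ (reuse 0)) y - gradient (f i) y)
        (-(minibatchGrad (G i) (ξ (reuse 1)) x - gradient (f i) x))
      rw [norm_neg] at this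
      refine le_trans (le_of_eq ?_) this
      congr 2; abel)
  refine hle.trans ?_
  rw [integral_add' (ia.const_mul 2) (ib.const_mul 2), integral_const_mul, integral_const_mul]
  simp only [Pi.sub_apply]
  linarith

lemma uMsg_moments (hG : IsStochasticOracle σ f 𝒟 G) (hC : IsCompressor ω ν C) (hω : 0 ≤ ω)
    (hb : 1 ≤ b) (reuse : Fin 3 → Fin 3) (x h : Vec d) (i : Fin N) :
    MemLp (uMsg (b := b) reuse G C x h i) 2 (clientLaw b 𝒟 ν i) ∧
    ∫ z, uMsg (b := b) reuse G C x h i z ∂(clientLaw b 𝒟 ν i) = gradient (f i) x - h ∧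
    ∫ z, ‖uMsg (b := b) reuse G C x h i z‖ ^ 2 ∂(clientLaw b 𝒟 ν i)
      ≤ (1 + ω) * (‖gradient (f i) x - h‖ ^ 2 + σ ^ 2 / b) := by
  obtain ⟨a1, a2, a3⟩ := hG.minibatch_eval hb i x (reuse 2)
  have b1 := a1.sub (memLp_const h)
  have hm : ∫ ξ : Fin 3 → Fin b → D, (minibatchGrad (G i) (ξ (reuse 2)) x - h)
      ∂(Measure.pi fun _ => Measure.pi fun _ => 𝒟 i) = gradient (f i) x - h := by
    rw [integral_sub (a1.integrable (by norm_num)) (integrable_const _), a2]; simp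
  obtain ⟨c1, c2, c3⟩ := (hC.comp_eval (1 : Fin 2)).compress b1
  refine ⟨c1, c2.trans hm, c3.trans (mul_le_mul_of_nonneg_left ?_ (by linarith))⟩
  have hs := integral_norm_sq_eq b1 hm
  simp only [Pi.sub_apply, sub_sub_sub_cancel_right] at hs ⊢
  rw [hs, add_comm]
  gcongr

end Client

end Frecon

namespace Frecon

/-! ### Smoothness of the objective and the descent inequality. -/

section Smooth

variable {d N : ℕ} {L : ℝ} {f : Fin N → Vec d → ℝ}

lemma IsSmoothFamily.hasGradientAt_objective (hf : IsSmoothFamily L f) (x : Vec d) :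
    HasGradientAt (objective f) ((1 / (N : ℝ)) • ∑ i, gradient (f i) x) x := by
  have h : ∀ i, HasFDerivAt (f i) (InnerProductSpace.toDual ℝ (Vec d) (gradient (f i) x)) x :=
    fun i => ((hf.differentiable i x).hasGradientAt).hasFDerivAt
  have h2 := (HasFDerivAt.fun_sum (u := Finset.univ) fun i _ => h i).const_mul (1 / (N : ℝ))
  rw [hasGradientAt_iff_hasFDerivAt]
  have e : InnerProductSpace.toDual ℝ (Vec d) ((1 / (N : ℝ)) • ∑ i, gradient (f i) x)
      = (1 / (N : ℝ)) • ∑ i, InnerProductSpace.toDual ℝ (Vec d) (gradient (f i) x) := by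
    ext v
    simp
  rw [e]
  exact h2

lemma IsSmoothFamily.gradient_objective (hf : IsSmoothFamily L f) (x : Vec d) :
    gradient (objective f) x = (1 / (N : ℝ)) • ∑ i, gradient (f i) x :=
  (hf.hasGradientAt_objective x).gradient

lemma IsSmoothFamily.continuous_gradient (hf : IsSmoothFamily L f) (i : Fin N) :
    Continuous (gradient (f i)) := by
  have : LipschitzWith L.toNNReal (gradient (f i)) := by
    refine LipschitzWith.of_dist_le_mul fun x y => ?_
    rw [dist_eq_norm, dist_eq_norm]
    exact (hf.lipschitz i x y).trans (by gcongr; exact Real.le_coe_toNNReal L)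
  exact this.continuous

lemma IsSmoothFamily.continuous_gradient_objective (hf : IsSmoothFamily L f) :
    Continuous (gradient (objective f)) := by
  have : gradient (objective f) = fun x => (1 / (N : ℝ)) • ∑ i, gradient (f i) x :=
    funext hf.gradient_objective
  rw [this]
  exact (continuous_finsetSum Finset.univ fun i _ => hf.continuous_gradient i).const_smul
    (1 / (N : ℝ))

lemma IsSmoothFamily.continuous_objective (hf : IsSmoothFamily L f) :
    Continuous (objective f) :=
  continuous_iff_continuousAt.2 fun x =>
    (hf.hasGradientAt_objective x).differentiableAt.continuousAt

lemma IsSmoothFamily.lipschitz_objective (hf : IsSmoothFamily L f) (hN : 1 ≤ N) (x y : Vec d) :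
    ‖gradient (objective f) x - gradient (objective f) y‖ ≤ L * ‖x - y‖ := by
  have hN' : (0 : ℝ) < N := by exact_mod_cast hN
  rw [hf.gradient_objective, hf.gradient_objective, ← smul_sub, ← Finset.sum_sub_distrib,
    norm_smul, Real.norm_of_nonneg (by positivity)]
  calc 1 / (N : ℝ) * ‖∑ i, (gradient (f i) x - gradient (f i) y)‖
      ≤ 1 / (N : ℝ) * ∑ _i : Fin N, L * ‖x - y‖ := by
        gcongr
        exact (norm_sum_le _ _).trans (Finset.sum_le_sum fun i _ => hf.lipschitz i x y)
    _ = L * ‖x - y‖ := by simp; field_simp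

/-- The descent lemma for a function with `L`-Lipschitz gradient. -/
lemma descent {F : Vec d → ℝ} (hF : Differentiable ℝ F)
    (hL : ∀ x y, ‖gradient F x - gradient F y‖ ≤ L * ‖x - y‖) (x v : Vec d) :
    F (x + v) ≤ F x + inner ℝ (gradient F x) v + L / 2 * ‖v‖ ^ 2 := by
  -- Along the segment, `φ` is `F` minus the linear and quadratic terms of the claimed upper bound.
  -- Lipschitz continuity of the gradient makes its derivative nonpositive on `(0, 1)`, and
  -- comparing the endpoints gives the claim.
  set φ : ℝ → ℝ := fun t =>
    F (x + t • v) - (t * inner ℝ (gradient F x) v + L / 2 * t ^ 2 * ‖v‖ ^ 2) with hφ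
  have hd : ∀ t, HasDerivAt φ (inner ℝ (gradient F (x + t • v)) v
      - (inner ℝ (gradient F x) v + L * t * ‖v‖ ^ 2)) t := by
    intro t
    have h1 : HasDerivAt (fun t : ℝ => x + t • v) v t := by
      simpa using ((hasDerivAt_id t).smul_const v).const_add x
    have h2 : HasDerivAt (fun t : ℝ => F (x + t • v)) (inner ℝ (gradient F (x + t • v)) v) t := by
      have := ((hF (x + t • v)).hasGradientAt.hasFDerivAt).comp_hasDerivAt t h1
      simp only [InnerProductSpace.toDual_apply_apply] at this
      exact this
    have h3 : HasDerivAt (fun t : ℝ => t * inner ℝ (gradient F x) v + L / 2 * t ^ 2 * ‖v‖ ^ 2)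
        (inner ℝ (gradient F x) v + L * t * ‖v‖ ^ 2) t := by
      have := ((hasDerivAt_id t).mul_const (inner ℝ (gradient F x) v)).add
        ((((hasDerivAt_id t).pow 2).const_mul (L / 2)).mul_const (‖v‖ ^ 2))
      refine this.congr_deriv ?_
      simp only [id, Nat.cast_ofNat]; ring
    exact h2.sub h3
  have hanti : AntitoneOn φ (Set.Icc 0 1) := by
    refine antitoneOn_of_deriv_nonpos (convex_Icc 0 1)
      (fun t _ => (hd t).continuousAt.continuousWithinAt)
      (fun t _ => (hd t).differentiableAt.differentiableWithinAt) fun t ht => ?_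
    rw [interior_Icc] at ht
    rw [(hd t).deriv]
    have h1 := real_inner_le_norm (gradient F (x + t • v) - gradient F x) v
    have h2 := hL (x + t • v) x
    rw [add_sub_cancel_left, norm_smul, Real.norm_of_nonneg ht.1.le] at h2
    rw [inner_sub_left] at h1
    nlinarith [mul_le_mul_of_nonneg_right h2 (norm_nonneg v)]
  have := hanti (Set.left_mem_Icc.2 zero_le_one) (Set.right_mem_Icc.2 zero_le_one) zero_le_one
  simp only [hφ, one_smul, zero_smul, add_zero] at this
  linarith

end Smooth

/-! ### Reduction of the state to a measurable core. -/

section Tuple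

variable {d N b : ℕ} {D Θ : Type*}

/-- Model, gradient estimator and local shifts: the part of the state that determines the rest. -/
abbrev Core (d N : ℕ) := Vec d × Vec d × (Fin N → Vec d)

/-- The state with given core whose global shift is the average of the local ones. -/
noncomputable def Core.toState (w : Core d N) : State d N := initState w.1 w.2.1 w.2.2

/-- One round of FRECON on cores. -/
noncomputable def coreStep (S : ℕ) (η α lam : ℝ) (reuse : Fin 3 → Fin 3)
    (G : Fin N → Vec d → D → Vec d) (C : Θ → Vec d → Vec d) (z : RoundNoise N b D Θ)
    (w : Core d N) : Core d N :=
  ((step S η α lam reuse G C z w.toState).x, (step S η α lam reuse G C z w.toState).g,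
    (step S η α lam reuse G C z w.toState).hLoc)

variable {S : ℕ} {η α lam : ℝ} {reuse : Fin 3 → Fin 3} {G : Fin N → Vec d → D → Vec d}
  {C : Θ → Vec d → Vec d}

/-- The global shift carries no information of its own: moving each sampled local shift by `α • u i`
moves their mean by `(α / N) • ∑ u i`, which is the update of `h`. The dynamics therefore lives on a
product of Euclidean spaces. -/
lemma step_toState (z : RoundNoise N b D Θ) (w : Core d N) :
    step S η α lam reuse G C z w.toState = (coreStep S η α lam reuse G C z w).toState := by
  have h : ∀ s : State d N, s = ⟨s.x, s.g, s.hLoc, s.h⟩ := fun _ => rfl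
  rw [h (step S η α lam reuse G C z w.toState)]
  simp only [Core.toState, coreStep, initState, State.mk.injEq, true_and]
  simp only [step]
  have : ∀ (A : Finset (Fin N)) (a c : Fin N → Vec d),
      ∑ i, (if i ∈ A then a i + α • c i else a i) = ∑ i, a i + α • ∑ i ∈ A, c i := by
    intro A a c
    rw [sum_mem_eq_sum_active A, Finset.smul_sum, ← Finset.sum_add_distrib]
    refine Finset.sum_congr rfl fun i _ => ?_
    by_cases hi : i ∈ A <;> simp [active, hi]
  rw [this, smul_add, smul_smul]
  congr 2; ring

/-- The run of FRECON on cores. -/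
noncomputable def coreRun (S : ℕ) (η α lam : ℝ) (reuse : Fin 3 → Fin 3)
    (G : Fin N → Vec d → D → Vec d) (C : Θ → Vec d → Vec d) (w : Core d N)
    (z : ℕ → RoundNoise N b D Θ) : ℕ → Core d N
  | 0 => w
  | t + 1 => coreStep S η α lam reuse G C (z t) (coreRun S η α lam reuse G C w z t)

lemma run_toState (w : Core d N) (z : ℕ → RoundNoise N b D Θ) (t : ℕ) :
    run S η α lam reuse G C w.toState z t = (coreRun S η α lam reuse G C w z t).toState := by
  induction t with
  | zero => rfl
  | succ t ih => rw [run, ih, step_toState, coreRun]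

lemma coreRun_congr (w : Core d N) {z z' : ℕ → RoundNoise N b D Θ} {t : ℕ}
    (h : ∀ r < t, z r = z' r) :
    coreRun S η α lam reuse G C w z t = coreRun S η α lam reuse G C w z' t := by
  induction t with
  | zero => rfl
  | succ t ih =>
    rw [coreRun, coreRun, h t t.lt_succ_self, ih fun r hr => h r (hr.trans t.lt_succ_self)]

variable [MeasurableSpace D] [MeasurableSpace Θ]

lemma measurable_coreStep (hG : ∀ i, Measurable (Function.uncurry (G i)))
    (hC : Measurable (Function.uncurry C)) :
    Measurable (fun p : RoundNoise N b D Θ × Core d N =>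
      coreStep S η α lam reuse G C p.1 p.2) := by
  have hgrad : ∀ (k : Fin 3) (i : Fin N) (y : RoundNoise N b D Θ × Core d N → Vec d),
      Measurable y → Measurable (fun p => minibatchGrad (G i) (p.1.2.1 i (reuse k)) (y p)) := by
    intro k i y hy
    unfold minibatchGrad
    refine Measurable.const_smul (Finset.measurable_fun_sum Finset.univ fun j _ => ?_) (1 / (b : ℝ))
    have : Measurable (fun p : RoundNoise N b D Θ × Core d N =>
        (y p, p.1.2.1 i (reuse k) j)) := by fun_prop
    exact (hG i).comp this
  have hcomp : ∀ (k : Fin 2) (i : Fin N) (y : RoundNoise N b D Θ × Core d N → Vec d),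
      Measurable y → Measurable (fun p => C (p.1.2.2 i k) (y p)) := by
    intro k i y hy
    have : Measurable (fun p : RoundNoise N b D Θ × Core d N => (p.1.2.2 i k, y p)) := by fun_prop
    exact hC.comp this
  have hact : ∀ i : Fin N, Measurable (fun p : RoundNoise N b D Θ × Core d N =>
      active p.1.1 i) := fun i =>
    (measurable_of_finite fun A : Finset (Fin N) => active A i).comp (by fun_prop)
  have hx : Measurable (fun p : RoundNoise N b D Θ × Core d N => p.2.1 - η • p.2.2.1) := by
    fun_prop
  have hq : ∀ i, Measurable (fun p : RoundNoise N b D Θ × Core d N => C (p.1.2.2 i 0)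
      (minibatchGrad (G i) (p.1.2.1 i (reuse 0)) (p.2.1 - η • p.2.2.1)
        - minibatchGrad (G i) (p.1.2.1 i (reuse 1)) p.2.1)) := fun i =>
    hcomp 0 i _ ((hgrad 0 i _ hx).sub (hgrad 1 i _ (by fun_prop)))
  have hu : ∀ i, Measurable (fun p : RoundNoise N b D Θ × Core d N => C (p.1.2.2 i 1)
      (minibatchGrad (G i) (p.1.2.1 i (reuse 2)) p.2.1 - p.2.2.2 i)) := fun i =>
    hcomp 1 i _ ((hgrad 2 i _ (by fun_prop)).sub (by fun_prop))
  -- A sum over a random index set becomes a sum over all clients with measurable indicator weights.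
  have hsum : ∀ y : Fin N → RoundNoise N b D Θ × Core d N → Vec d, (∀ i, Measurable (y i)) →
      Measurable (fun p => ∑ i ∈ p.1.1, y i p) := by
    intro y hy
    have h : (fun p : RoundNoise N b D Θ × Core d N => ∑ i ∈ p.1.1, y i p)
        = fun p => ∑ i, active p.1.1 i • y i p :=
      funext fun p => sum_mem_eq_sum_active p.1.1 fun i => y i p
    rw [h]
    exact Finset.measurable_fun_sum _ fun i _ => (hact i).smul (hy i)
  refine hx.prodMk (Measurable.prodMk ?_ ?_)
  · simp only [step, Core.toState, initState]
    have h1 := hsum _ hq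
    have h2 := hsum _ hu
    fun_prop
  · refine measurable_pi_lambda _ fun i => ?_
    simp only [step, Core.toState, initState]
    have hrw : ∀ (A : Finset (Fin N)) (a c : Vec d),
        (if i ∈ A then a + α • c else a) = a + active A i • (α • c) := by
      intro A a c; by_cases hi : i ∈ A <;> simp [active, hi]
    simp_rw [hrw]
    have h1 := hact i
    have h2 := hu i
    fun_prop

end Tuple

end Frecon

namespace Frecon

/-! ### Balancing the terms of the potential. -/

section Arithmetic

/-- The one-round decrease of the potential, with `A = (1 + ω) N / S`, `B = (1 + ω) / S`,
`e = ‖g - ∇f(x)‖²`, `n = ‖∇f(x)‖²`, `q = ‖g‖²`, `H` the mean squared shift error and `v` the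
variance of a minibatch gradient. -/
lemma potential_decrease_arith {A B L η F F' e n q H v E' H' : ℝ} (hA : 1 ≤ A) (hB : 0 < B)
    (hη : 0 < η) (hq : 0 ≤ q) (he : 0 ≤ e) (hH : 0 ≤ H) (hv : 0 ≤ v)
    (hstep : L * η + 10 * (A * B) * (L * η) ^ 2 ≤ 1)
    (hF : F' ≤ F + η / 2 * (e - n - q) + L / 2 * (η ^ 2 * q))
    (hE : E' ≤ (1 - 1 / (2 * A)) ^ 2 * e + 2 * B * (L ^ 2 * (η ^ 2 * q) + 4 * v)
      + 2 * (1 / (2 * A)) ^ 2 * B * (H + v))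
    (hH' : H' ≤ (1 + 1 / A / 2) * ((1 - 1 / A) * H + 1 / A * v) + 3 * A * (L ^ 2 * (η ^ 2 * q))) :
    η / 2 * n + (F' + η * (A * E' + B * H'))
      ≤ (F + η * (A * e + B * H)) + 10 * η * (A * B) * v := by
  have hA0 : 0 < A := by linarith
  set γ : ℝ := 1 / A with hγ
  have hγ0 : 0 < γ := by positivity
  have hAγ : A * γ = 1 := by rw [hγ]; field_simp
  have hγ1 : γ ≤ 1 := by rw [hγ, div_le_one hA0]; exact hA
  have hlam : 1 / (2 * A) = γ / 2 := by rw [hγ]; field_simp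
  rw [hlam] at hE
  have hBγ : B * γ ≤ A * B := by
    rw [mul_comm A B]; exact mul_le_mul_of_nonneg_left (hγ1.trans hA) hB.le
  have h1 : A * E' ≤ A * ((1 - γ / 2) ^ 2 * e + 2 * B * (L ^ 2 * (η ^ 2 * q) + 4 * v)
      + 2 * (γ / 2) ^ 2 * B * (H + v)) := mul_le_mul_of_nonneg_left hE hA0.le
  have h2 : B * H' ≤ B * ((1 + γ / 2) * ((1 - γ) * H + γ * v) + 3 * A * (L ^ 2 * (η ^ 2 * q))) :=
    mul_le_mul_of_nonneg_left hH' hB.le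
  have e1 : A * ((1 - γ / 2) ^ 2 * e + 2 * B * (L ^ 2 * (η ^ 2 * q) + 4 * v)
      + 2 * (γ / 2) ^ 2 * B * (H + v)) = (A - 1 + γ / 4) * e
      + 2 * (A * B) * (L ^ 2 * (η ^ 2 * q)) + 8 * (A * B) * v + B * γ / 2 * (H + v) := by
    have : A * γ ^ 2 = γ := by rw [pow_two, ← mul_assoc, hAγ, one_mul]
    linear_combination (-e) * hAγ + (e / 4 + B / 2 * (H + v)) * this
  have e2 : B * ((1 + γ / 2) * ((1 - γ) * H + γ * v) + 3 * A * (L ^ 2 * (η ^ 2 * q)))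
      = (B - B * γ / 2 - B * γ ^ 2 / 2) * H + (1 + γ / 2) * (B * γ) * v
        + 3 * (A * B) * (L ^ 2 * (η ^ 2 * q)) := by ring
  -- With `γ = 1/A`, the estimator error creates `Bγ/2 · H`, exactly cancelled by the `-Bγ/2 · H`
  -- left over from the shift contraction. The movement terms add up to `2 + 3 = 5` and the noise to
  -- at most `8 + 2 = 10` multiples of `A * B`.
  have h3 : A * E' + B * H' ≤ (A - 1 / 2) * e - e / 2 + γ / 4 * e + B * H
      + 5 * (A * B) * (L ^ 2 * (η ^ 2 * q)) + 10 * (A * B) * v := by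
    have i1 : 0 ≤ B * γ ^ 2 / 2 * H := by positivity
    have i2 : (1 + γ / 2) * (B * γ) * v + B * γ / 2 * v ≤ 2 * (A * B) * v := by
      have h0 : γ * (B * γ) ≤ 1 * (B * γ) :=
        mul_le_mul_of_nonneg_right hγ1 (mul_pos hB hγ0).le
      have : (1 + γ / 2) * (B * γ) + B * γ / 2 ≤ 2 * (A * B) := by linarith
      have := mul_le_mul_of_nonneg_right this hv
      linarith
    rw [e1] at h1; rw [e2] at h2
    linarith
  have h4 : A * E' + B * H' ≤ A * e - e / 2 + B * H
      + 5 * (A * B) * (L ^ 2 * (η ^ 2 * q)) + 10 * (A * B) * v := by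
    have := mul_le_mul_of_nonneg_right hγ1 he
    linarith
  have h5 := mul_le_mul_of_nonneg_left h4 hη.le
  -- Half of this inequality says that `-η/2 * q` absorbs both the quadratic term of the descent
  -- inequality and the movement term with factor `5`. The surplus `-e / 2` in `h4` cancels the `η/2
  -- * e` in `hF`.
  have h6 := mul_le_mul_of_nonneg_left (mul_le_mul_of_nonneg_right hstep hq) hη.le
  linarith

end Arithmetic

/-! ### Conditional error estimates for one round. -/

section OneRound

variable {d N S b : ℕ} {D Θ : Type*} [MeasurableSpace D] [MeasurableSpace Θ]
  {L σ ω η : ℝ} {f : Fin N → Vec d → ℝ} {𝒟 : Fin N → Measure D}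
  [∀ i, IsProbabilityMeasure (𝒟 i)] {G : Fin N → Vec d → D → Vec d}
  {ν : Measure Θ} [IsProbabilityMeasure ν] {C : Θ → Vec d → Vec d} {reuse : Fin 3 → Fin 3}

/-- Collects the randomness of the clients into the randomness of a round. -/
def gather (p : Finset (Fin N) × (Fin N → ClientNoise b D Θ)) : RoundNoise N b D Θ :=
  (p.1, fun i => (p.2 i).1, fun i => (p.2 i).2)

/-- The sampling estimates need one independent random variable per client, while `roundLaw` groups
the randomness into data and seeds; transposing the product identifies the two laws. -/
lemma measurePreserving_gather (hSN : S ≤ N) :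
    MeasurePreserving (gather (N := N) (b := b) (D := D) (Θ := Θ))
      ((sampleLaw N S).prod (Measure.pi (clientLaw b 𝒟 ν))) (roundLaw N S b 𝒟 ν) := by
  have := isProbabilityMeasure_sampleLaw hSN
  exact (MeasurePreserving.id (sampleLaw N S)).prod
    (measurePreserving_arrowProdEquivProdArrow (Fin 3 → Fin b → D) (Fin 2 → Θ) (Fin N)
      (fun i => Measure.pi fun _ : Fin 3 => Measure.pi fun _ : Fin b => 𝒟 i)
      (fun _ => Measure.pi fun _ : Fin 2 => ν))

/-- The expected squared error of the gradient estimator after one round. -/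
lemma estimator_error (hf : IsSmoothFamily L f) (hG : IsStochasticOracle σ f 𝒟 G)
    (hC : IsCompressor ω ν C) (hω : 0 ≤ ω) (hb : 1 ≤ b) (h1 : 1 ≤ S) (h2 : S ≤ N)
    (α lam : ℝ) (w : Core d N) :
    Integrable (fun p => ‖(coreStep S η α lam reuse G C (gather p) w).2.1
        - gradient (objective f) (w.1 - η • w.2.1)‖ ^ 2)
      ((sampleLaw N S).prod (Measure.pi (clientLaw b 𝒟 ν))) ∧
    ∫ p, ‖(coreStep S η α lam reuse G C (gather p) w).2.1
        - gradient (objective f) (w.1 - η • w.2.1)‖ ^ 2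
        ∂((sampleLaw N S).prod (Measure.pi (clientLaw b 𝒟 ν)))
      ≤ (1 - lam) ^ 2 * ‖w.2.1 - gradient (objective f) w.1‖ ^ 2
        + 2 * ((1 + ω) / S) * (L ^ 2 * (η ^ 2 * ‖w.2.1‖ ^ 2) + 4 * (σ ^ 2 / b))
        + 2 * lam ^ 2 * ((1 + ω) / S)
          * ((1 / (N : ℝ)) * ∑ i, ‖w.2.2 i - gradient (f i) w.1‖ ^ 2 + σ ^ 2 / b) := by
  obtain ⟨x, g, h⟩ := w
  have hS : (0 : ℝ) < S := by exact_mod_cast h1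
  have hN : (0 : ℝ) < N := by exact_mod_cast h1.trans h2
  set y := x - η • g with hy
  set hbar : Vec d := (1 / (N : ℝ)) • ∑ i, h i with hhbar
  set Y : Fin N → ClientNoise b D Θ → Vec d := fun i z =>
    qMsg reuse G C x y i z + lam • uMsg reuse G C x (h i) i z with hYdef
  set c : Vec d := (1 - lam) • g + lam • hbar - gradient (objective f) y with hc
  have hq := fun i => qMsg_moments hG hC hω hb reuse x y i
  have hu := fun i => uMsg_moments hG hC hω hb reuse x (h i) i
  have hY : ∀ i, MemLp (Y i) 2 (clientLaw b 𝒟 ν i) := fun i =>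
    (hq i).1.add ((hu i).1.const_smul lam)
  have hstep : ∀ p : Finset (Fin N) × (Fin N → ClientNoise b D Θ),
      (coreStep S η α lam reuse G C (gather p) (x, g, h)).2.1 - gradient (objective f) y
        = c + (1 / (S : ℝ)) • ∑ i ∈ p.1, Y i (p.2 i) := by
    intro p
    have : (coreStep S η α lam reuse G C (gather p) (x, g, h)).2.1
        = (1 / (S : ℝ)) • ∑ i ∈ p.1, qMsg reuse G C x y i (p.2 i) + (1 - lam) • g
          + lam • ((1 / (S : ℝ)) • ∑ i ∈ p.1, uMsg reuse G C x (h i) i (p.2 i) + hbar) := rfl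
    rw [this, hc, hYdef, Finset.sum_add_distrib, ← Finset.smul_sum]
    module
  dsimp only
  simp_rw [hstep]
  obtain ⟨k1, k2⟩ := integral_norm_add_sampled_sq_le h1 h2 hY c
  refine ⟨k1, k2.trans ?_⟩
  have hmean : ∀ i, ∫ z, Y i z ∂(clientLaw b 𝒟 ν i)
      = (gradient (f i) y - gradient (f i) x) + lam • (gradient (f i) x - h i) := by
    intro i
    rw [← (hq i).2.1, ← (hu i).2.1, ← integral_smul]
    exact integral_add ((hq i).1.integrable (by norm_num))
      (((hu i).1.const_smul lam).integrable (by norm_num))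
  -- The increments of `∇f` cancel, and the mean of the local shifts cancels against `hbar`; only
  -- the old estimator error survives.
  have hbias : c + (1 / (N : ℝ)) • ∑ i, ∫ z, Y i z ∂(clientLaw b 𝒟 ν i)
      = (1 - lam) • (g - gradient (objective f) x) := by
    simp_rw [hmean]
    rw [Finset.sum_add_distrib, ← Finset.smul_sum, Finset.sum_sub_distrib, Finset.sum_sub_distrib,
      hc, hf.gradient_objective, hf.gradient_objective, hhbar]
    module
  have hsec : ∀ i, ∫ z, ‖Y i z‖ ^ 2 ∂(clientLaw b 𝒟 ν i)
      ≤ 2 * ((1 + ω) * (L ^ 2 * (η ^ 2 * ‖g‖ ^ 2) + 4 * (σ ^ 2 / b)))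
        + 2 * (lam ^ 2 * ((1 + ω) * (‖h i - gradient (f i) x‖ ^ 2 + σ ^ 2 / b))) := by
    intro i
    have iq := memLp_two_norm_sq (hq i).1
    have iu := memLp_two_norm_sq (hu i).1
    have hle : ∫ z, ‖Y i z‖ ^ 2 ∂(clientLaw b 𝒟 ν i)
        ≤ ∫ z, (2 * ‖qMsg reuse G C x y i z‖ ^ 2
          + 2 * (lam ^ 2 * ‖uMsg reuse G C x (h i) i z‖ ^ 2)) ∂(clientLaw b 𝒟 ν i) := by
      refine integral_mono (memLp_two_norm_sq (hY i))
        ((iq.const_mul 2).add ((iu.const_mul (lam ^ 2)).const_mul 2)) fun z => ?_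
      have := norm_add_sq_le_two (qMsg reuse G C x y i z) (lam • uMsg reuse G C x (h i) i z)
      rw [norm_smul lam, mul_pow, Real.norm_eq_abs, sq_abs] at this
      exact this
    refine hle.trans ?_
    rw [integral_add (iq.const_mul 2) ((iu.const_mul (lam ^ 2)).const_mul 2), integral_const_mul,
      integral_const_mul, integral_const_mul]
    have hlip : ‖gradient (f i) y - gradient (f i) x‖ ^ 2 ≤ L ^ 2 * (η ^ 2 * ‖g‖ ^ 2) := by
      have h3 := hf.lipschitz i y x
      have h4 : ‖y - x‖ = |η| * ‖g‖ := by
        rw [hy, sub_sub_cancel_left, norm_neg, norm_smul, Real.norm_eq_abs]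
      calc ‖gradient (f i) y - gradient (f i) x‖ ^ 2 ≤ (L * ‖y - x‖) ^ 2 := by gcongr
        _ = _ := by rw [h4, mul_pow, mul_pow, sq_abs]
    have h5 := (hq i).2.2
    have h6 := (hu i).2.2
    rw [norm_sub_rev (gradient (f i) x) (h i)] at h6
    gcongr
    exact h5.trans (by gcongr)
  rw [hbias, norm_smul, mul_pow, Real.norm_eq_abs, sq_abs, add_assoc]
  gcongr
  calc 1 / ((S : ℝ) * N) * ∑ i, ∫ z, ‖Y i z‖ ^ 2 ∂(clientLaw b 𝒟 ν i)
      ≤ 1 / ((S : ℝ) * N) * ∑ i, (2 * ((1 + ω) * (L ^ 2 * (η ^ 2 * ‖g‖ ^ 2) + 4 * (σ ^ 2 / b)))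
        + 2 * (lam ^ 2 * ((1 + ω) * (‖h i - gradient (f i) x‖ ^ 2 + σ ^ 2 / b)))) := by
        gcongr with i; exact hsec i
    _ = _ := by
        simp only [Finset.sum_add_distrib, ← Finset.mul_sum, Finset.sum_const, Finset.card_univ,
          Fintype.card_fin, nsmul_eq_mul]
        field_simp

/-- The expected squared error of a local shift after one round. -/
lemma shift_error (hf : IsSmoothFamily L f) (hG : IsStochasticOracle σ f 𝒟 G)
    (hC : IsCompressor ω ν C) (hω : 0 ≤ ω) (hb : 1 ≤ b) (h1 : 1 ≤ S) (h2 : S ≤ N)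
    (lam : ℝ) (w : Core d N) {A : ℝ} (hA : A = (1 + ω) * N / S) (i : Fin N) :
    Integrable (fun p => ‖(coreStep S η (1 / (1 + ω)) lam reuse G C (gather p) w).2.2 i
        - gradient (f i) (w.1 - η • w.2.1)‖ ^ 2)
      ((sampleLaw N S).prod (Measure.pi (clientLaw b 𝒟 ν))) ∧
    ∫ p, ‖(coreStep S η (1 / (1 + ω)) lam reuse G C (gather p) w).2.2 i
        - gradient (f i) (w.1 - η • w.2.1)‖ ^ 2
        ∂((sampleLaw N S).prod (Measure.pi (clientLaw b 𝒟 ν)))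
      ≤ (1 + 1 / A / 2) * ((1 - 1 / A) * ‖w.2.2 i - gradient (f i) w.1‖ ^ 2
          + 1 / A * (σ ^ 2 / b)) + 3 * A * (L ^ 2 * (η ^ 2 * ‖w.2.1‖ ^ 2)) := by
  obtain ⟨x, g, h⟩ := w
  have hS : (0 : ℝ) < S := by exact_mod_cast h1
  have hSN : (S : ℝ) ≤ N := by exact_mod_cast h2
  have hN : (0 : ℝ) < N := by linarith
  have hw : 0 < 1 + ω := by linarith
  set y := x - η • g with hy
  set α : ℝ := 1 / (1 + ω) with hα
  set v : ℝ := σ ^ 2 / b with hv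
  obtain ⟨u1, u2, u3⟩ := uMsg_moments hG hC hω hb reuse x (h i) i
  have hA1 : 1 ≤ A := by
    rw [hA, one_le_div hS]; nlinarith
  have hA0 : 0 < A := by linarith
  have hstep : ∀ p : Finset (Fin N) × (Fin N → ClientNoise b D Θ),
      ‖(coreStep S η α lam reuse G C (gather p) (x, g, h)).2.2 i - gradient (f i) y‖ ^ 2
        = if i ∈ p.1 then
            ‖(h i + α • uMsg reuse G C x (h i) i (p.2 i)) - gradient (f i) y‖ ^ 2
          else ‖h i - gradient (f i) y‖ ^ 2 := by
    intro p
    have : (coreStep S η α lam reuse G C (gather p) (x, g, h)).2.2 i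
        = if i ∈ p.1 then h i + α • uMsg reuse G C x (h i) i (p.2 i) else h i := rfl
    rw [this]; split_ifs <;> rfl
  have hm := (memLp_const (μ := clientLaw b 𝒟 ν i) (p := 2) (h i)).add (u1.const_smul α)
  obtain ⟨k1, k2⟩ := integral_sampled_ite (ρ := clientLaw b 𝒟 ν) h1 h2 i
    (memLp_two_norm_sq (hm.sub (memLp_const (gradient (f i) y)))) (‖h i - gradient (f i) y‖ ^ 2)
  dsimp only
  simp_rw [hstep]
  refine ⟨k1, k2.le.trans ?_⟩
  have hlip : ‖gradient (f i) x - gradient (f i) y‖ ^ 2 ≤ L ^ 2 * (η ^ 2 * ‖g‖ ^ 2) := by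
    have h3 := hf.lipschitz i x y
    have h4 : ‖x - y‖ = |η| * ‖g‖ := by
      rw [hy, sub_sub_cancel, norm_smul, Real.norm_eq_abs]
    calc ‖gradient (f i) x - gradient (f i) y‖ ^ 2 ≤ (L * ‖x - y‖) ^ 2 := by gcongr
      _ = _ := by rw [h4, mul_pow, mul_pow, sq_abs]
  -- Young's inequality with parameter `1/(2A)` spends half of the contraction `1/A`; the drift
  -- factor `1 + 2A` is at most `3A` because `A ≥ 1`.
  have hyoung : ∀ a : Vec d, ‖a - gradient (f i) y‖ ^ 2
      ≤ (1 + 1 / A / 2) * ‖a - gradient (f i) x‖ ^ 2 + 3 * A * (L ^ 2 * (η ^ 2 * ‖g‖ ^ 2)) := by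
    intro a
    have e : a - gradient (f i) y = (a - gradient (f i) x) + (gradient (f i) x - gradient (f i) y) :=
      by abel
    rw [e, norm_add_sq_real]
    set p := a - gradient (f i) x
    set r := gradient (f i) x - gradient (f i) y
    have hpr := real_inner_le_norm p r
    have hsq : 2 * (‖p‖ * ‖r‖) ≤ 1 / A / 2 * ‖p‖ ^ 2 + 2 * A * ‖r‖ ^ 2 := by
      have h5 : 0 ≤ 1 / (2 * A) * (‖p‖ - 2 * A * ‖r‖) ^ 2 := by positivity
      have h6 : 1 / (2 * A) * (‖p‖ - 2 * A * ‖r‖) ^ 2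
          = 1 / A / 2 * ‖p‖ ^ 2 + 2 * A * ‖r‖ ^ 2 - 2 * (‖p‖ * ‖r‖) := by field_simp; ring
      linarith
    have h7 : ‖r‖ ^ 2 ≤ A * ‖r‖ ^ 2 := le_mul_of_one_le_left (by positivity) hA1
    have h8 := mul_le_mul_of_nonneg_left hlip (show 0 ≤ 3 * A by positivity)
    linarith
  -- The choice `α = 1/(1+ω)` gives `α²(1+ω) = α`, so the compressor's second moment costs only `α`
  -- against the gain `2α` from the cross term.
  have hx : ∫ z, ‖(h i + α • uMsg reuse G C x (h i) i z) - gradient (f i) x‖ ^ 2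
      ∂(clientLaw b 𝒟 ν i) ≤ (1 - α) * ‖h i - gradient (f i) x‖ ^ 2 + α * v := by
    have e : ∀ z : ClientNoise b D Θ, ‖(h i + α • uMsg reuse G C x (h i) i z) - gradient (f i) x‖ ^ 2
        = ‖(α • uMsg reuse G C x (h i) i) z - (gradient (f i) x - h i)‖ ^ 2 := by
      intro z; congr 2; simp only [Pi.smul_apply]; abel
    simp_rw [e]
    rw [integral_norm_sub_sq (u1.const_smul α)]
    simp only [Pi.smul_apply, norm_smul, mul_pow, Real.norm_eq_abs, sq_abs]
    rw [integral_const_mul, integral_smul, u2, real_inner_smul_left, real_inner_self_eq_norm_sq,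
      norm_sub_rev (h i)]
    rw [hα] at *
    have h3 := mul_le_mul_of_nonneg_left u3 (show 0 ≤ (1 / (1 + ω)) ^ 2 by positivity)
    have h4 : (1 / (1 + ω)) ^ 2 * ((1 + ω) * (‖gradient (f i) x - h i‖ ^ 2 + v))
        = 1 / (1 + ω) * (‖gradient (f i) x - h i‖ ^ 2 + v) := by field_simp
    linarith
  have hin : ∫ z, ‖(h i + α • uMsg reuse G C x (h i) i z) - gradient (f i) y‖ ^ 2
      ∂(clientLaw b 𝒟 ν i) ≤ (1 + 1 / A / 2) * ((1 - α) * ‖h i - gradient (f i) x‖ ^ 2 + α * v)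
        + 3 * A * (L ^ 2 * (η ^ 2 * ‖g‖ ^ 2)) := by
    have ix := memLp_two_norm_sq (hm.sub (memLp_const (gradient (f i) x)))
    have hle := integral_mono (memLp_two_norm_sq (hm.sub (memLp_const (gradient (f i) y))))
      ((ix.const_mul (1 + 1 / A / 2)).add (integrable_const (3 * A * (L ^ 2 * (η ^ 2 * ‖g‖ ^ 2)))))
      fun z => hyoung (h i + α • uMsg reuse G C x (h i) i z)
    refine hle.trans ?_
    rw [integral_add' (ix.const_mul _) (integrable_const _), integral_const_mul]
    simp only [integral_const, probReal_univ, one_smul]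
    gcongr
    exact hx
  have hp0 : 0 ≤ (S : ℝ) / N := by positivity
  have hp1 : 0 ≤ 1 - (S : ℝ) / N := by rw [sub_nonneg, div_le_one hN]; exact hSN
  have hAα : (S : ℝ) / N * α = 1 / A := by rw [hA, hα]; field_simp
  have t1 := mul_le_mul_of_nonneg_left hin hp0
  have t2 := mul_le_mul_of_nonneg_left (hyoung (h i)) hp1
  refine (add_le_add t1 t2).trans (le_of_eq ?_)
  rw [← hAα]; ring

end OneRound

end Frecon

namespace Frecon

/-! ### Telescoping the potential along the random run. -/

section Chain

variable {d N S b : ℕ} {D Θ : Type*} [MeasurableSpace D] [MeasurableSpace Θ]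
  {L σ ω η : ℝ} {f : Fin N → Vec d → ℝ} {𝒟 : Fin N → Measure D}
  [∀ i, IsProbabilityMeasure (𝒟 i)] {G : Fin N → Vec d → D → Vec d}
  {ν : Measure Θ} [IsProbabilityMeasure ν] {C : Θ → Vec d → Vec d} {reuse : Fin 3 → Fin 3}

/-- The potential of a state with given core. -/
noncomputable def potential (f : Fin N → Vec d → ℝ) (η ω : ℝ) (S : ℕ) (w : Core d N) : ℝ :=
  initialPotential f η ω S w.1 w.2.1 w.2.2

lemma potential_nonneg (hbdd : BddBelow (Set.range (objective f))) (hω : 0 ≤ ω) (hη : 0 ≤ η)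
    (w : Core d N) : 0 ≤ potential f η ω S w := by
  have h1 : 0 ≤ objective f w.1 - ⨅ x, objective f x := sub_nonneg.2 (ciInf_le hbdd w.1)
  have h2 : 0 ≤ ∑ i, ‖w.2.2 i - gradient (f i) w.1‖ ^ 2 :=
    Finset.sum_nonneg fun i _ => by positivity
  have h3 : 0 ≤ 1 + ω := by linarith
  unfold potential initialPotential
  positivity

lemma IsSmoothFamily.measurable_potential (hf : IsSmoothFamily L f) :
    Measurable (potential f η ω S) := by
  have h1 := hf.continuous_objective.measurable
  have h2 := hf.continuous_gradient_objective.measurable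
  have h3 := fun i => (hf.continuous_gradient i).measurable
  unfold potential initialPotential
  have h4 : Measurable (fun w : Core d N => ∑ i, ‖w.2.2 i - gradient (f i) w.1‖ ^ 2) :=
    Finset.measurable_fun_sum _ fun i _ => by
      have : Measurable (fun w : Core d N => gradient (f i) w.1) := (h3 i).comp measurable_fst
      fun_prop
  fun_prop

/-- With `y = Lη` and `r` the square root in `maxStep`, the step bound reads `y + y r ≤ 1`. Then `y
r ≤ 1`, so `(y r)² ≤ y r`, while `r²` is ten times the product of the two weights. -/
lemma maxStep_condition (hL : 0 < L) (hη : 0 < η) (hmax : η ≤ maxStep L ω N S) :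
    L * η + 10 * ((1 + ω) * N / S * ((1 + ω) / S)) * (L * η) ^ 2 ≤ 1 := by
  have hr := Real.sqrt_nonneg (10 * (1 + ω) ^ 2 * N / (S : ℝ) ^ 2)
  have hrs : Real.sqrt (10 * (1 + ω) ^ 2 * N / (S : ℝ) ^ 2) ^ 2
      = 10 * ((1 + ω) * N / S * ((1 + ω) / S)) := by
    rw [Real.sq_sqrt (by positivity)]; ring
  rw [maxStep] at hmax
  rw [← hrs]
  set r := Real.sqrt (10 * (1 + ω) ^ 2 * N / (S : ℝ) ^ 2)
  rw [le_div_iff₀ (by positivity)] at hmax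
  have hy : 0 < L * η := by positivity
  set y := L * η with hydef
  have h1 : y + y * r ≤ 1 := by rw [hydef]; linarith
  have h2 : 0 ≤ y * r := by positivity
  have h3 : y * r ≤ 1 := by linarith
  have h4 : (y * r) * (y * r) ≤ 1 * (y * r) := mul_le_mul_of_nonneg_right h3 h2
  linarith

lemma potential_round (hf : IsSmoothFamily L f) (hG : IsStochasticOracle σ f 𝒟 G)
    (hC : IsCompressor ω ν C) (hω : 0 ≤ ω) (hb : 1 ≤ b) (h1 : 1 ≤ S) (h2 : S ≤ N) (hL : 0 < L)
    (hη : 0 < η) (hmax : η ≤ maxStep L ω N S) (w : Core d N) :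
    Integrable (fun p => potential f η ω S
        (coreStep S η (1 / (1 + ω)) (S / (2 * (1 + ω) * N)) reuse G C (gather p) w))
      ((sampleLaw N S).prod (Measure.pi (clientLaw b 𝒟 ν))) ∧
    η / 2 * ‖gradient (objective f) w.1‖ ^ 2 + ∫ p, potential f η ω S
        (coreStep S η (1 / (1 + ω)) (S / (2 * (1 + ω) * N)) reuse G C (gather p) w)
        ∂((sampleLaw N S).prod (Measure.pi (clientLaw b 𝒟 ν)))
      ≤ potential f η ω S w
        + 10 * η * ((1 + ω) * N / S * ((1 + ω) / S)) * (σ ^ 2 / b) := by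
  have := isProbabilityMeasure_sampleLaw h2
  have hS : (0 : ℝ) < S := by exact_mod_cast h1
  have hSN : (S : ℝ) ≤ N := by exact_mod_cast h2
  have hN : (0 : ℝ) < N := by linarith
  have hw : 0 < 1 + ω := by linarith
  set lam : ℝ := S / (2 * (1 + ω) * N) with hlam
  obtain ⟨a1, a2⟩ := estimator_error (η := η) (reuse := reuse) hf hG hC hω hb h1 h2
    (1 / (1 + ω)) lam w
  have hs := shift_error (η := η) (reuse := reuse) hf hG hC hω hb h1 h2 lam w
    (A := (1 + ω) * N / S) rfl
  have hA1 : 1 ≤ (1 + ω) * N / S := by rw [one_le_div hS]; nlinarith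
  have hBpos : 0 < (1 + ω) / (S : ℝ) := by positivity
  have hlamA : lam = 1 / (2 * ((1 + ω) * N / S)) := by rw [hlam]; field_simp
  have hdef : ∀ p : Finset (Fin N) × (Fin N → ClientNoise b D Θ), potential f η ω S
      (coreStep S η (1 / (1 + ω)) lam reuse G C (gather p) w)
      = (objective f (w.1 - η • w.2.1) - ⨅ x, objective f x)
        + η * ((1 + ω) * N / S * ‖(coreStep S η (1 / (1 + ω)) lam reuse G C (gather p) w).2.1
            - gradient (objective f) (w.1 - η • w.2.1)‖ ^ 2
          + (1 + ω) / S * ((1 / (N : ℝ)) *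
            ∑ i, ‖(coreStep S η (1 / (1 + ω)) lam reuse G C (gather p) w).2.2 i
              - gradient (f i) (w.1 - η • w.2.1)‖ ^ 2)) := fun p => rfl
  simp_rw [hdef]
  have b1 := a1.const_mul ((1 + ω) * N / S)
  have b2 := ((integrable_finsetSum Finset.univ fun i _ => (hs i).1).const_mul
    (1 / (N : ℝ))).const_mul ((1 + ω) / S)
  have b3 := (b1.fun_add b2).const_mul η
  refine ⟨(integrable_const _).add b3, ?_⟩
  rw [integral_add (integrable_const _) b3, integral_const_mul, integral_add b1 b2,
    integral_const_mul, integral_const_mul, integral_const_mul,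
    integral_finsetSum Finset.univ fun i _ => (hs i).1]
  simp only [integral_const, probReal_univ, one_smul]
  unfold potential initialPotential
  refine potential_decrease_arith (L := L) (q := ‖w.2.1‖ ^ 2)
    (e := ‖w.2.1 - gradient (objective f) w.1‖ ^ 2)
    (H := 1 / (N : ℝ) * ∑ i, ‖w.2.2 i - gradient (f i) w.1‖ ^ 2)
    hA1 hBpos hη (by positivity) (by positivity)
    (mul_nonneg (by positivity) (Finset.sum_nonneg fun i _ => by positivity)) (by positivity)
    (maxStep_condition hL hη hmax) ?_ (by rw [← hlamA]; exact a2) ?_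
  · have hd := descent (fun x => (hf.hasGradientAt_objective x).differentiableAt)
      (hf.lipschitz_objective (h1.trans h2)) w.1 (-(η • w.2.1))
    rw [← sub_eq_add_neg, inner_neg_right, inner_smul_right, norm_neg, norm_smul, mul_pow,
      Real.norm_eq_abs, sq_abs] at hd
    have he := norm_sub_sq_real w.2.1 (gradient (objective f) w.1)
    rw [real_inner_comm] at he
    rw [he]
    linarith
  · refine (mul_le_mul_of_nonneg_left (Finset.sum_le_sum fun i (_ : i ∈ Finset.univ) => (hs i).2)
      (show 0 ≤ 1 / (N : ℝ) by positivity)).trans (le_of_eq ?_)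
    simp only [Finset.sum_add_distrib, ← Finset.mul_sum, Finset.sum_const, Finset.card_univ,
      Fintype.card_fin, nsmul_eq_mul]
    field_simp

/-- Passing to `ENNReal` lets rounds be chained before any integrability along the run is known.
Boundedness below makes the potential nonnegative, so `ENNReal.ofReal` loses nothing. -/
lemma lintegral_potential_round (hf : IsSmoothFamily L f)
    (hbdd : BddBelow (Set.range (objective f))) (hG : IsStochasticOracle σ f 𝒟 G)
    (hC : IsCompressor ω ν C) (hω : 0 ≤ ω) (hb : 1 ≤ b) (h1 : 1 ≤ S) (h2 : S ≤ N) (hL : 0 < L)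
    (hη : 0 < η) (hmax : η ≤ maxStep L ω N S) (w : Core d N) :
    ENNReal.ofReal (η / 2 * ‖gradient (objective f) w.1‖ ^ 2)
      + ∫⁻ z, ENNReal.ofReal (potential f η ω S
        (coreStep S η (1 / (1 + ω)) (S / (2 * (1 + ω) * N)) reuse G C z w)) ∂(roundLaw N S b 𝒟 ν)
      ≤ ENNReal.ofReal (potential f η ω S w)
        + ENNReal.ofReal (10 * η * ((1 + ω) * N / S * ((1 + ω) / S)) * (σ ^ 2 / b)) := by
  obtain ⟨hi, hle⟩ := potential_round (reuse := reuse) hf hG hC hω hb h1 h2 hL hη hmax w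
  have hV : ∀ w : Core d N, 0 ≤ potential f η ω S w := potential_nonneg hbdd hω hη.le
  have hmeas : Measurable (fun z : RoundNoise N b D Θ => ENNReal.ofReal (potential f η ω S
      (coreStep S η (1 / (1 + ω)) (S / (2 * (1 + ω) * N)) reuse G C z w))) :=
    (hf.measurable_potential.comp ((measurable_coreStep hG.measurable hC.measurable).comp
      measurable_prodMk_right)).ennreal_ofReal
  rw [← (measurePreserving_gather h2).lintegral_comp hmeas,
    ← ofReal_integral_eq_lintegral_ofReal hi (Filter.Eventually.of_forall fun p => hV _),
    ← ENNReal.ofReal_add (by positivity) (integral_nonneg fun p => hV _),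
    ← ENNReal.ofReal_add (hV w) (by positivity)]
  exact ENNReal.ofReal_le_ofReal hle

variable {α lam : ℝ}

lemma measurable_coreRun (hG : ∀ i, Measurable (Function.uncurry (G i)))
    (hC : Measurable (Function.uncurry C)) (w : Core d N) {Y : Type*} [MeasurableSpace Y]
    {z : ℕ → Y → RoundNoise N b D Θ} (hz : ∀ r, Measurable (z r)) (t : ℕ) :
    Measurable (fun y => coreRun S η α lam reuse G C w (fun r => z r y) t) := by
  induction t with
  | zero => exact measurable_const
  | succ t ih => exact (measurable_coreStep hG hC).comp ((hz t).prodMk ih)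

variable {Ω : Type*} [MeasurableSpace Ω] {P : Measure Ω} [IsProbabilityMeasure P]
  {Z : ℕ → Ω → RoundNoise N b D Θ}

/-- The state at the beginning of a round is independent of the randomness of the round. -/
lemma coreRun_indep (hG : ∀ i, Measurable (Function.uncurry (G i)))
    (hC : Measurable (Function.uncurry C)) (hZ : ∀ t, AEMeasurable (Z t) P)
    (hind : iIndepFun Z P) (w : Core d N) (t : ℕ) :
    AEMeasurable (fun o => coreRun S η α lam reuse G C w (fun r => Z r o) t) P ∧
    IndepFun (fun o => coreRun S η α lam reuse G C w (fun r => Z r o) t) (Z t) P := by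
  classical
  obtain ⟨o₀⟩ : Nonempty Ω := P.nonempty_of_neZero
  -- The state at time `t` depends only on rounds `r < t`; padding later rounds with the arbitrary
  -- constant `Z 0 o₀` exhibits it as a measurable function of a finite tuple, independent of `Z t`.
  set z : ℕ → (Finset.range t → RoundNoise N b D Θ) → RoundNoise N b D Θ := fun r y =>
    if h : r ∈ Finset.range t then y ⟨r, h⟩ else Z 0 o₀ with hz
  have hzm : ∀ r, Measurable (z r) := by
    intro r
    by_cases h : r ∈ Finset.range t
    · simp only [hz, h, dif_pos]; exact measurable_pi_apply _
    · simp only [hz, h, dif_neg, not_false_eq_true]; exact measurable_const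
  have hF := measurable_coreRun (S := S) (η := η) (α := α) (lam := lam) (reuse := reuse)
    hG hC w hzm t
  have heq : (fun o => coreRun S η α lam reuse G C w (fun r => Z r o) t)
      = (fun y => coreRun S η α lam reuse G C w (fun r => z r y) t)
        ∘ fun o (i : Finset.range t) => Z i o := by
    ext1 o
    refine coreRun_congr w fun r hr => ?_
    simp [hz, hr]
  rw [heq]
  refine ⟨hF.comp_aemeasurable (aemeasurable_pi_lambda _ fun i => hZ i), ?_⟩
  have := hind.indepFun_finset₀ (Finset.range t) {t} (by simp) hZ
  exact this.comp hF (measurable_pi_apply (⟨t, Finset.mem_singleton_self t⟩ : ({t} : Finset ℕ)))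

/-- Independence makes the joint law of state and fresh noise a product, so Tonelli allows the state
to be frozen while integrating over the round. -/
lemma lintegral_coreRun_succ (hG : ∀ i, Measurable (Function.uncurry (G i)))
    (hC : Measurable (Function.uncurry C)) {μ : Measure (RoundNoise N b D Θ)} [SFinite μ]
    (hZ : ∀ t, HasLaw (Z t) μ P)
    (hind : iIndepFun Z P) (w : Core d N) (t : ℕ) {V : Core d N → ENNReal} (hV : Measurable V) :
    ∫⁻ o, V (coreRun S η α lam reuse G C w (fun r => Z r o) (t + 1)) ∂P
      = ∫⁻ o, ∫⁻ z, V (coreStep S η α lam reuse G C z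
          (coreRun S η α lam reuse G C w (fun r => Z r o) t)) ∂μ ∂P := by
  obtain ⟨hX, hXZ⟩ := coreRun_indep (S := S) (η := η) (α := α) (lam := lam) (reuse := reuse)
    hG hC (fun t => (hZ t).aemeasurable) hind w t
  have hmap := (indepFun_iff_map_prod_eq_prod_map_map hX (hZ t).aemeasurable).1 hXZ
  rw [(hZ t).map_eq] at hmap
  have hΨ : Measurable (fun p : Core d N × RoundNoise N b D Θ =>
      V (coreStep S η α lam reuse G C p.2 p.1)) :=
    hV.comp ((measurable_coreStep hG hC).comp measurable_swap)
  calc ∫⁻ o, V (coreRun S η α lam reuse G C w (fun r => Z r o) (t + 1)) ∂P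
      = ∫⁻ p, V (coreStep S η α lam reuse G C p.2 p.1) ∂(P.map fun o =>
          (coreRun S η α lam reuse G C w (fun r => Z r o) t, Z t o)) :=
        (lintegral_map' hΨ.aemeasurable (hX.prodMk (hZ t).aemeasurable)).symm
    _ = ∫⁻ x, ∫⁻ z, V (coreStep S η α lam reuse G C z x) ∂μ
          ∂(P.map fun o => coreRun S η α lam reuse G C w (fun r => Z r o) t) := by
        rw [hmap, lintegral_prod _ hΨ.aemeasurable]
    _ = _ := lintegral_map' hΨ.lintegral_prod_right'.aemeasurable hX

/-- Each round trades potential for squared gradient plus noise; keeping the final potential on the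
left makes the induction close. -/
lemma sum_lintegral_gradient_le (hf : IsSmoothFamily L f)
    (hbdd : BddBelow (Set.range (objective f))) (hG : IsStochasticOracle σ f 𝒟 G)
    (hC : IsCompressor ω ν C) (hω : 0 ≤ ω) (hb : 1 ≤ b) (h1 : 1 ≤ S) (h2 : S ≤ N) (hL : 0 < L)
    (hη : 0 < η) (hmax : η ≤ maxStep L ω N S) (hZ : ∀ t, HasLaw (Z t) (roundLaw N S b 𝒟 ν) P)
    (hind : iIndepFun Z P) (w : Core d N) {X : ℕ → Ω → Core d N}
    (hX : X = fun t o => coreRun S η (1 / (1 + ω)) (S / (2 * (1 + ω) * N)) reuse G C w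
      (fun r => Z r o) t) (T : ℕ) :
    ∑ t ∈ Finset.range T,
        ∫⁻ o, ENNReal.ofReal (η / 2 * ‖gradient (objective f) (X t o).1‖ ^ 2) ∂P
      + ∫⁻ o, ENNReal.ofReal (potential f η ω S (X T o)) ∂P
      ≤ ENNReal.ofReal (potential f η ω S w)
        + T * ENNReal.ofReal (10 * η * ((1 + ω) * N / S * ((1 + ω) / S)) * (σ ^ 2 / b)) := by
  have := isProbabilityMeasure_sampleLaw h2
  have hsf : SFinite (roundLaw N S b 𝒟 ν) := by unfold roundLaw; infer_instance
  set n := ENNReal.ofReal (10 * η * ((1 + ω) * N / S * ((1 + ω) / S)) * (σ ^ 2 / b))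
  induction T with
  | zero => simp [hX, coreRun]
  | succ T ih =>
    have hXm : AEMeasurable (X T) P := by
      rw [hX]
      exact (coreRun_indep hG.measurable hC.measurable (fun t => (hZ t).aemeasurable) hind w T).1
    have hgm : AEMeasurable (fun o =>
        ENNReal.ofReal (η / 2 * ‖gradient (objective f) (X T o).1‖ ^ 2)) P := by
      have h3 := hf.continuous_gradient_objective.measurable
      have h4 : Measurable (fun w : Core d N =>
          ENNReal.ofReal (η / 2 * ‖gradient (objective f) w.1‖ ^ 2)) :=
        (((h3.comp measurable_fst).norm.pow_const 2).const_mul _).ennreal_ofReal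
      exact h4.comp_aemeasurable hXm
    have hround : ∫⁻ o, ENNReal.ofReal (η / 2 * ‖gradient (objective f) (X T o).1‖ ^ 2) ∂P
        + ∫⁻ o, ENNReal.ofReal (potential f η ω S (X (T + 1) o)) ∂P
        ≤ ∫⁻ o, ENNReal.ofReal (potential f η ω S (X T o)) ∂P + n := by
      have h5 := lintegral_coreRun_succ (S := S) (η := η) (α := 1 / (1 + ω))
        (lam := S / (2 * (1 + ω) * N)) (reuse := reuse) hG.measurable hC.measurable hZ hind w T
        (V := fun w => ENNReal.ofReal (potential f η ω S w))
        hf.measurable_potential.ennreal_ofReal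
      have h6 : ∫⁻ o, ENNReal.ofReal (potential f η ω S (X (T + 1) o)) ∂P
          = ∫⁻ o, ∫⁻ z, ENNReal.ofReal (potential f η ω S (coreStep S η (1 / (1 + ω))
            (S / (2 * (1 + ω) * N)) reuse G C z (X T o))) ∂(roundLaw N S b 𝒟 ν) ∂P := by
        rw [hX]; exact h5
      rw [h6, ← lintegral_add_left' hgm]
      calc _ ≤ ∫⁻ o, (ENNReal.ofReal (potential f η ω S (X T o)) + n) ∂P :=
            lintegral_mono fun o =>
              lintegral_potential_round hf hbdd hG hC hω hb h1 h2 hL hη hmax (X T o)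
        _ = _ := by rw [lintegral_add_right _ measurable_const]; simp
    rw [Finset.sum_range_succ, add_assoc]
    refine (add_le_add le_rfl hround).trans ?_
    rw [← add_assoc]
    refine (add_le_add ih le_rfl).trans (le_of_eq ?_)
    push_cast
    ring

lemma sum_integral_gradient_le (hf : IsSmoothFamily L f)
    (hbdd : BddBelow (Set.range (objective f))) (hG : IsStochasticOracle σ f 𝒟 G)
    (hC : IsCompressor ω ν C) (hω : 0 ≤ ω) (hb : 1 ≤ b) (h1 : 1 ≤ S) (h2 : S ≤ N) (hL : 0 < L)
    (hη : 0 < η) (hmax : η ≤ maxStep L ω N S) (hZ : ∀ t, HasLaw (Z t) (roundLaw N S b 𝒟 ν) P)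
    (hind : iIndepFun Z P) (w : Core d N) {X : ℕ → Ω → Core d N}
    (hX : X = fun t o => coreRun S η (1 / (1 + ω)) (S / (2 * (1 + ω) * N)) reuse G C w
      (fun r => Z r o) t) :
    (∀ t, MemLp (fun o => gradient (objective f) (X t o).1) 2 P) ∧
    ∀ T : ℕ, η / 2 * ∑ t ∈ Finset.range T, ∫ o, ‖gradient (objective f) (X t o).1‖ ^ 2 ∂P
      ≤ potential f η ω S w
        + T * (10 * η * ((1 + ω) * N / S * ((1 + ω) / S)) * (σ ^ 2 / b)) := by
  have hsum := fun T => le_self_add.trans (sum_lintegral_gradient_le hf hbdd hG hC hω hb h1 h2 hL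
    hη hmax hZ hind w hX T)
  have hm : ∀ t, AEStronglyMeasurable (fun o => gradient (objective f) (X t o).1) P := by
    intro t
    have hXm : AEMeasurable (X t) P := by
      rw [hX]
      exact (coreRun_indep hG.measurable hC.measurable (fun t => (hZ t).aemeasurable) hind w t).1
    exact ((hf.continuous_gradient_objective.measurable.comp measurable_fst).comp_aemeasurable
      hXm).aestronglyMeasurable
  have hsq : ∀ t, AEStronglyMeasurable
      (fun o => η / 2 * ‖gradient (objective f) (X t o).1‖ ^ 2) P := fun t =>
    ((hm t).norm.pow 2).const_mul _
  have hint : ∀ t, Integrable (fun o => η / 2 * ‖gradient (objective f) (X t o).1‖ ^ 2) P := by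
    intro t
    refine ⟨hsq t, ?_⟩
    rw [hasFiniteIntegral_iff_ofReal (Filter.Eventually.of_forall fun o => by positivity)]
    -- Finiteness of the `t`-th term is itself a consequence of the telescoped bound, taken at
    -- horizon `t + 1` so that the sum contains it.
    refine lt_of_le_of_lt ((Finset.single_le_sum (f := fun t => ∫⁻ o, ENNReal.ofReal
      (η / 2 * ‖gradient (objective f) (X t o).1‖ ^ 2) ∂P) (fun _ _ => zero_le)
      (Finset.self_mem_range_succ t)).trans (hsum (t + 1))) ?_
    exact ENNReal.add_lt_top.2 ⟨ENNReal.ofReal_lt_top,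
      ENNReal.mul_lt_top (ENNReal.natCast_lt_top _) ENNReal.ofReal_lt_top⟩
  refine ⟨fun t => (memLp_two_iff_integrable_sq_norm (hm t)).2 ?_, fun T => ?_⟩
  · have := (hint t).const_mul (2 / η)
    refine this.congr (Filter.Eventually.of_forall fun o => ?_)
    simp only; field_simp
  · have hV := potential_nonneg (S := S) hbdd hω hη.le w
    have h3 := hsum T
    simp_rw [fun t => (ofReal_integral_eq_lintegral_ofReal (hint t)
      (Filter.Eventually.of_forall fun o => by positivity)).symm] at h3
    rw [← ENNReal.ofReal_sum_of_nonneg fun t _ => integral_nonneg fun o => by positivity,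
      ← ENNReal.ofReal_natCast, ← ENNReal.ofReal_mul (by positivity),
      ← ENNReal.ofReal_add hV (by positivity), ENNReal.ofReal_le_ofReal_iff (by positivity)] at h3
    simp_rw [integral_const_mul, ← Finset.mul_sum] at h3
    exact h3

end Chain

/-! ### From the telescoped bound to the complexity. -/

section Rate

/-- The number of rounds and the batch size make the averaged squared gradient at most `ε ^ 2`. -/
lemma rate_arith {N S b T : ℕ} {L σ ω η ε V Q : ℝ} (h1 : 1 ≤ S) (h2 : S ≤ N) (hb : 1 ≤ b)
    (hT : 1 ≤ T) (hL : 0 < L) (hω : 0 ≤ ω) (hη : 0 < η) (hε : 0 < ε) (hV : 0 ≤ V)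
    (hbatch : 40 * ((1 + ω) ^ 2 * N * σ ^ 2 / ((S : ℝ) ^ 2 * ε ^ 2)) ≤ b)
    (hrounds : 16 * (maxStep L ω N S / η) * V
      * (L / ε ^ 2 + L * (1 + ω) * Real.sqrt N / (S * ε ^ 2)) ≤ T)
    (hQ : η / 2 * Q ≤ V + T * (10 * η * ((1 + ω) * N / S * ((1 + ω) / S)) * (σ ^ 2 / b))) :
    Q ≤ T * ε ^ 2 := by
  have hS : (0 : ℝ) < S := by exact_mod_cast h1
  have hN : (0 : ℝ) < N := by exact_mod_cast h1.trans h2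
  have hb' : (0 : ℝ) < b := by exact_mod_cast hb
  have hT' : (0 : ℝ) < T := by exact_mod_cast hT
  have hw : 0 < 1 + ω := by linarith
  -- The constant `40` turns the per-round noise into `10 η ε²/40 = η ε²/4`; together with `V ≤ T η
  -- ε²/4` from `hinit` this gives exactly `η/2 * (T ε²)`.
  have hnoise : (1 + ω) * N / S * ((1 + ω) / S) * (σ ^ 2 / b) ≤ ε ^ 2 / 40 := by
    have e : (1 + ω) * N / S * ((1 + ω) / S) * (σ ^ 2 / b)
        = (40 * ((1 + ω) ^ 2 * N * σ ^ 2 / ((S : ℝ) ^ 2 * ε ^ 2))) / b * (ε ^ 2 / 40) := by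
      field_simp
    rw [e]
    have : (40 * ((1 + ω) ^ 2 * N * σ ^ 2 / ((S : ℝ) ^ 2 * ε ^ 2))) / b ≤ 1 :=
      (div_le_one hb').2 hbatch
    exact mul_le_of_le_one_left (by positivity) this
  have hinit : 4 * V ≤ T * (η * ε ^ 2) := by
    set s : ℝ := (1 + ω) * Real.sqrt N / S with hs
    have hs0 : 0 ≤ s := by positivity
    have hsqrt : Real.sqrt (10 * (1 + ω) ^ 2 * N / (S : ℝ) ^ 2) ≤ 4 * s := by
      rw [Real.sqrt_le_iff]
      refine ⟨by positivity, ?_⟩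
      have : (4 * s) ^ 2 = 16 * (1 + ω) ^ 2 * N / (S : ℝ) ^ 2 := by
        rw [hs, mul_pow, div_pow, mul_pow, Real.sq_sqrt hN.le]; ring
      rw [this]
      gcongr
      norm_num
    have hfac : L / ε ^ 2 + L * (1 + ω) * Real.sqrt N / (S * ε ^ 2) = L * (1 + s) / ε ^ 2 := by
      rw [hs]; field_simp
    -- As `√10 ≤ 4`, the denominator of `maxStep` is at most `L(1 + 4s) ≤ 4L(1 + s)`. This factor
    -- `4` and the `4` in `hinit` give the constant `16`.
    have hmax : 1 ≤ 4 * (maxStep L ω N S * (L * (1 + s))) := by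
      rw [maxStep, one_div, inv_mul_eq_div, ← mul_div_assoc, one_le_div (by positivity)]
      nlinarith [mul_le_mul_of_nonneg_left hsqrt hL.le, mul_nonneg hL.le hs0]
    rw [hfac] at hrounds
    have e : 16 * (maxStep L ω N S / η) * V * (L * (1 + s) / ε ^ 2) * (η * ε ^ 2)
        = 4 * V * (4 * (maxStep L ω N S * (L * (1 + s)))) := by field_simp; ring
    have h3 := mul_le_mul_of_nonneg_right hrounds (show 0 ≤ η * ε ^ 2 by positivity)
    rw [e] at h3
    exact (le_mul_of_one_le_right (by positivity) hmax).trans h3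
  have h4 := mul_le_mul_of_nonneg_left hnoise (show 0 ≤ T * (10 * η) by positivity)
  have h5 : η / 2 * Q ≤ η / 2 * (T * ε ^ 2) := by linarith
  exact le_of_mul_le_mul_left h5 (by positivity)

end Rate

end Frecon

theorem mainTheorem2 :
    ∃ C₁ C₂ : ℝ, 0 < C₁ ∧ 0 < C₂ ∧
    ∀ {D Θ Ω : Type*} [MeasurableSpace D] [MeasurableSpace Θ] [MeasurableSpace Ω]
      (d N S b T : ℕ) (L σ ω η ε : ℝ)
      (f : Fin N → Frecon.Vec d → ℝ)
      (𝒟 : Fin N → Measure D) [∀ i, IsProbabilityMeasure (𝒟 i)]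
      (G : Fin N → Frecon.Vec d → D → Frecon.Vec d)
      (ν : Measure Θ) [IsProbabilityMeasure ν] (C : Θ → Frecon.Vec d → Frecon.Vec d)
      (reuse : Fin 3 → Fin 3)
      (x₀ g₀ : Frecon.Vec d) (h₀ : Fin N → Frecon.Vec d)
      (P : Measure Ω) [IsProbabilityMeasure P] (Z : ℕ → Ω → Frecon.RoundNoise N b D Θ),
      1 ≤ S → S ≤ N → 1 ≤ b → 1 ≤ T → 0 < L → 0 ≤ σ → 0 ≤ ω → 0 < ε →
      Frecon.IsSmoothFamily L f →
      BddBelow (Set.range (Frecon.objective f)) →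
      Frecon.IsStochasticOracle σ f 𝒟 G →
      Frecon.IsCompressor ω ν C →
      (∀ t, HasLaw (Z t) (Frecon.roundLaw N S b 𝒟 ν) P) →
      iIndepFun Z P →
      0 < η → η ≤ Frecon.maxStep L ω N S →
      C₁ * ((1 + ω) ^ 2 * N * σ ^ 2 / ((S : ℝ) ^ 2 * ε ^ 2)) ≤ b →
      C₂ * (Frecon.maxStep L ω N S / η) * Frecon.initialPotential f η ω S x₀ g₀ h₀
        * (L / ε ^ 2 + L * (1 + ω) * Real.sqrt N / (S * ε ^ 2)) ≤ T →
      let x : ℕ → Ω → Frecon.Vec d := fun t o =>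
        (Frecon.run S η (1 / (1 + ω)) (S / (2 * (1 + ω) * N)) reuse G C
          (Frecon.initState x₀ g₀ h₀) (fun r => Z r o) t).x
      (∀ t, Integrable (fun o => ‖gradient (Frecon.objective f) (x t o)‖) P) ∧
      (1 / (T : ℝ)) * ∑ t ∈ Finset.range T,
        ∫ o, ‖gradient (Frecon.objective f) (x t o)‖ ∂P ≤ ε := by

  refine ⟨40, 16, by norm_num, by norm_num, ?_⟩
  intro D Θ Ω _ _ _ d N S b T L σ ω η ε f 𝒟 _ G ν _ C reuse x₀ g₀ h₀ P _ Z hS hSN hb hT hL _ hω hε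
    hf hbdd hG hC hZ hind hη hmax hbatch hrounds x
  obtain ⟨X, hX⟩ : ∃ X : ℕ → Ω → Frecon.Core d N, X = fun t o =>
      Frecon.coreRun S η (1 / (1 + ω)) (S / (2 * (1 + ω) * N)) reuse G C (x₀, g₀, h₀)
        (fun r => Z r o) t := ⟨_, rfl⟩
  have hxX : ∀ t o, x t o = (X t o).1 := by
    intro t o
    have h := Frecon.run_toState (S := S) (η := η) (α := 1 / (1 + ω))
      (lam := S / (2 * (1 + ω) * N)) (reuse := reuse) (G := G) (C := C) (x₀, g₀, h₀)
      (fun r => Z r o) t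
    rw [hX]
    exact congrArg Frecon.State.x h
  simp_rw [hxX]
  obtain ⟨hL2, hsum⟩ := Frecon.sum_integral_gradient_le hf hbdd hG hC hω hb hS hSN hL hη hmax hZ
    hind (x₀, g₀, h₀) hX
  have hint : ∀ t, Integrable (fun o => ‖gradient (Frecon.objective f) (X t o).1‖) P :=
    fun t => ((hL2 t).integrable (by norm_num)).norm
  refine ⟨hint, ?_⟩
  have hQ := Frecon.rate_arith hS hSN hb hT hL hω hη hε
    (Frecon.potential_nonneg hbdd hω hη.le (x₀, g₀, h₀)) hbatch hrounds (hsum T)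
  have hT' : (0 : ℝ) < T := by exact_mod_cast hT
  -- This is `2ε‖∇f‖ ≤ ε² + ‖∇f‖²`; averaged over rounds, each half contributes at most `ε/2`.
  have hpt : ∀ t, ∫ o, ‖gradient (Frecon.objective f) (X t o).1‖ ∂P
      ≤ ε / 2 + 1 / (2 * ε) * ∫ o, ‖gradient (Frecon.objective f) (X t o).1‖ ^ 2 ∂P := by
    intro t
    have hsq := (Frecon.memLp_two_norm_sq (hL2 t)).const_mul (1 / (2 * ε))
    have hle := integral_mono (hint t) ((integrable_const (ε / 2)).add hsq) fun o => by
      have h1 : 0 ≤ 1 / (2 * ε) * (‖gradient (Frecon.objective f) (X t o).1‖ - ε) ^ 2 := by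
        positivity
      have h2 : 1 / (2 * ε) * (‖gradient (Frecon.objective f) (X t o).1‖ - ε) ^ 2
          = ε / 2 + 1 / (2 * ε) * ‖gradient (Frecon.objective f) (X t o).1‖ ^ 2
            - ‖gradient (Frecon.objective f) (X t o).1‖ := by field_simp; ring
      simp only [Pi.add_apply]
      linarith
    rw [integral_add' (integrable_const _) hsq, integral_const_mul] at hle
    simpa using hle
  calc 1 / (T : ℝ) * ∑ t ∈ Finset.range T, ∫ o, ‖gradient (Frecon.objective f) (X t o).1‖ ∂P
      ≤ 1 / (T : ℝ) * ∑ t ∈ Finset.range T, (ε / 2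
          + 1 / (2 * ε) * ∫ o, ‖gradient (Frecon.objective f) (X t o).1‖ ^ 2 ∂P) := by
        gcongr with t; exact hpt t
    _ = ε / 2 + 1 / (T * (2 * ε)) * ∑ t ∈ Finset.range T,
          ∫ o, ‖gradient (Frecon.objective f) (X t o).1‖ ^ 2 ∂P := by
        rw [Finset.sum_add_distrib, ← Finset.mul_sum, Finset.sum_const, Finset.card_range,
          nsmul_eq_mul]
        field_simp
    _ ≤ ε / 2 + 1 / (T * (2 * ε)) * (T * ε ^ 2) := by gcongr
    _ = ε := by field_simp; ring
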